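/- We work over $\mathbb{C}$. Let $N$ be a lattice (a free abelian group of finite rank) with dual lattice $M$, let $\Sigma$ be a fan in $N_{\mathbb{Q}}$ (not necessarily complete), that is, a finite nonempty set of strongly convex polyhedral cones closed under taking faces and such that any two meet in a common face, and let $X=X_\Sigma$ be the associated normal toric variety, glued from the affine toric varieties $U_\sigma=\operatorname{Spec}\mathbb{C}[\sigma^\vee\cap M]$, $\sigma\in\Sigma$. For a ray $\rho\in\Sigma(1)$ let $u_\rho\in N$ be its primitive generator and $D_\rho$ the corresponding torus invariant prime divisor. For $\sigma\in\Sigma$ let $\sigma(1)$ be the set of its rays. Assume that $X$ is $\mathbb{Q}$-factorial, i.e. every prime divisor of $X$ has a positive multiple that is Cartier. Let $m_\rho\ge 1$ ($\rho\in\Sigma(1)$) be integers and let $$\Delta=\sum_{\rho\in\Sigma(1)}\Bigl(1-\frac1{m_\rho}\Bigr)D_\rho .$$ By an orbifold chart of $(X,\Delta)$ we mean a smooth irreducible affine variety $V$ with a faithful action of a finite group $G$ together with a morphism $\pi\colon V\to X$ that identifies $V/G$ with an open subvariety of $X$, such that for every prime divisor $E$ of $V$ the coefficient of $\Delta$ at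 $\overline{\pi(E)}$ is $1-\frac1e$, where $e$ is the ramification index of $\pi$ along $E$. **Proposition 3.1.** The pair $(X,\Delta)$ is an orbifold: every point of $X$ lies in the image of an orbifold chart of $(X,\Delta)$. More precisely, such charts are given by the log Cox construction. For every cone $\sigma\in\Sigma$ the vectors $u_\rho$, $\rho\in\sigma(1)$, are linearly independent. Let $(w_j)_{j\in J}$ be any family of vectors of $N$ that completes them to a $\mathbb{Q}$-basis of $N_{\mathbb{Q}}$ (so $J=\emptyset$ if $\sigma$ is full-dimensional). Let $P\colon\mathbb{Z}^{\sigma(1)}\oplus\mathbb{Z}^J\to N$ be the lattice homomorphism with $e_\rho\mapsto m_\rho u_\rho$ and $e_j\mapsto w_j$, and let $H=\operatorname{Hom}(\operatorname{coker}P^*,\mathbb{C}^\times)$, where $P^*\colon M\to\mathbb{Z}^{\sigma(1)}\oplus\mathbb{Z}^J$ is the dual of $P$. Then $H$ is a finite abelian group, and the toric morphism $$\pi\colon \operatorname{Spec}\mathbb{C}\bigl[x_\rho,\,t_j^{\pm1} : \rho\in\sigma(1),\,j\in J\bigr]\longrightarrow U_\sigma\subseteq X,\qquad \pi^*\chi^{m}=\prod_{\rho\in\sigma(1)}x_\rho^{\,m_\rho\langle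 m,u_\rho\rangle}\prod_{j\in J}t_j^{\langle m,w_j\rangle},$$ with the action of $H$ that multiplies a monomial of degree $d\in\operatorname{coker}P^*$ by the value at $d$ of the character, is an orbifold chart of $(X,\Delta)$ with image $U_\sigma$. It ramifies over $D_\rho$, $\rho\in\sigma(1)$, with order exactly $m_\rho$. In particular, if $\sigma$ is full-dimensional, then $U_\sigma$ is a quotient of an affine space by a finite abelian group. -/

import Mathlib

open CategoryTheory AlgebraicGeometry TensorProduct
open scoped AddMonoidAlgebra

noncomputable section

/-! ### Cones and fans -/

namespace Toric

variable {N : Type} [AddCommGroup N]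

/-- The pairing of a character `m ∈ M = Hom(N, ℤ)` with vectors of `N_ℚ = ℚ ⊗ N`. -/
def pairing (m : Module.Dual ℤ N) : ℚ ⊗[ℤ] N →ₗ[ℚ] ℚ := m.baseChange ℚ

/-- A lattice vector `v ∈ N`, seen in `N_ℚ`. -/
def vec (v : N) : ℚ ⊗[ℤ] N := 1 ⊗ₜ v

@[simp] lemma pairing_tmul (m : Module.Dual ℤ N) (q : ℚ) (v : N) :
    pairing m (q ⊗ₜ v) = m v * q := by
  simp [pairing]

@[simp] lemma pairing_vec (m : Module.Dual ℤ N) (v : N) : pairing m (vec v) = m v := by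
  simp [vec]

lemma pairing_add (m m' : Module.Dual ℤ N) (x : ℚ ⊗[ℤ] N) :
    pairing (m + m') x = pairing m x + pairing m' x := by
  simp [pairing]

lemma pairing_zero (x : ℚ ⊗[ℤ] N) : pairing (0 : Module.Dual ℤ N) x = 0 := by
  simp [pairing]

lemma pairing_neg (m : Module.Dual ℤ N) (x : ℚ ⊗[ℤ] N) : pairing (-m) x = -pairing m x := by
  simp [pairing]

lemma pairing_nsmul (k : ℕ) (m : Module.Dual ℤ N) (x : ℚ ⊗[ℤ] N) :
    pairing (k • m) x = k * pairing m x := by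
  induction k with
  | zero => simp [pairing_zero]
  | succ k ih => rw [succ_nsmul, pairing_add, ih]; push_cast; ring

/-- The semigroup `S_σ = σ^∨ ∩ M` of characters that are nonnegative on the cone `σ`. -/
def dualMonoid (σ : PointedCone ℚ (ℚ ⊗[ℤ] N)) : AddSubmonoid (Module.Dual ℤ N) where
  carrier := {m | ∀ x ∈ σ, 0 ≤ pairing m x}
  zero_mem' x _ := by simp [pairing_zero]
  add_mem' ha hb x hx := by rw [pairing_add]; exact add_nonneg (ha x hx) (hb x hx)

lemma dualMonoid_anti {σ τ : PointedCone ℚ (ℚ ⊗[ℤ] N)} (h : τ ≤ σ) :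
    dualMonoid σ ≤ dualMonoid τ := fun _ hm x hx => hm x (h hx)

/-- `τ` is a face of `σ`: it is cut out of `σ` by a hyperplane `m^⊥` with `m ∈ σ^∨ ∩ M`. -/
def IsFace (τ σ : PointedCone ℚ (ℚ ⊗[ℤ] N)) : Prop :=
  ∃ m ∈ dualMonoid σ, ∀ x, x ∈ τ ↔ x ∈ σ ∧ pairing m x = 0

lemma IsFace.le {τ σ : PointedCone ℚ (ℚ ⊗[ℤ] N)} (h : IsFace τ σ) : τ ≤ σ := by
  obtain ⟨m, -, h⟩ := h
  exact fun x hx => ((h x).1 hx).1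

/-- The ray `ℚ_{≥0} v` spanned by a lattice vector. -/
def rayCone (v : N) : PointedCone ℚ (ℚ ⊗[ℤ] N) := PointedCone.hull ℚ {vec v}

/-- A lattice vector is primitive if it is not a proper multiple of another one. -/
def IsPrimitive (v : N) : Prop := ∀ (k : ℤ) (w : N), v = k • w → IsUnit k

end Toric

/-- A fan in `N_ℚ`: a finite nonempty collection of strongly convex (rational) polyhedral cones,
closed under faces, such that any two of them meet in a common face. -/
structure Fan (N : Type) [AddCommGroup N] where
  cones : Set (PointedCone ℚ (ℚ ⊗[ℤ] N))
  finite : cones.Finite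
  nonempty : cones.Nonempty
  fg : ∀ σ ∈ cones, σ.FG
  salient : ∀ σ ∈ cones, ∀ x ∈ σ, -x ∈ σ → x = 0
  face_mem : ∀ σ ∈ cones, ∀ τ, Toric.IsFace τ σ → τ ∈ cones
  inf_isFace : ∀ σ ∈ cones, ∀ τ ∈ cones, Toric.IsFace (σ ⊓ τ) σ

namespace Toric

variable {N : Type} [AddCommGroup N]

/-! ### Passing to a face is a localization of semigroup algebras -/

/-- The inclusion `ℂ[A] → ℂ[B]` of semigroup algebras for `A ≤ B`. -/
def inclHom {M : Type} [AddCommGroup M] {A B : AddSubmonoid M} (h : A ≤ B) : ℂ[A] →+* ℂ[B] :=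
  AddMonoidAlgebra.mapDomainRingHom ℂ (AddSubmonoid.inclusion h)

lemma isLocalization_inclHom {M : Type} [AddCommGroup M] {A B : AddSubmonoid M} (h : A ≤ B)
    (m : A) (hm : -(m : M) ∈ B) (H : ∀ b ∈ B, ∃ k : ℕ, b + k • (m : M) ∈ A) :
    let _ := (inclHom h).toAlgebra
    IsLocalization.Away (AddMonoidAlgebra.single m (1 : ℂ)) ℂ[B] := by
  let _ := (inclHom h).toAlgebra
  have hs : ∀ (a : A) (c : ℂ), algebraMap ℂ[A] ℂ[B] (AddMonoidAlgebra.single a c) =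
      AddMonoidAlgebra.single (AddSubmonoid.inclusion h a) c := fun a c => by
    simp [RingHom.algebraMap_toAlgebra, inclHom]
  have hinj : Function.Injective (algebraMap ℂ[A] ℂ[B]) :=
    AddMonoidAlgebra.mapDomain_injective (AddSubmonoid.inclusion_injective h)
  refine IsLocalization.Away.mk _ ?_ ?_ ?_
  · rw [hs]
    refine IsUnit.of_mul_eq_one (AddMonoidAlgebra.single ⟨-(m : M), hm⟩ (1 : ℂ)) ?_
    rw [AddMonoidAlgebra.single_mul_single, AddMonoidAlgebra.one_def]
    congr 1
    · ext; simp
    · simp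
  · intro s
    induction s using AddMonoidAlgebra.induction_linear with
    | zero => exact ⟨0, 0, by simp⟩
    | add f g hf hg =>
      obtain ⟨n, a, ha⟩ := hf
      obtain ⟨n', a', ha'⟩ := hg
      refine ⟨n + n', a * (AddMonoidAlgebra.single m 1) ^ n' +
        a' * (AddMonoidAlgebra.single m 1) ^ n, ?_⟩
      rw [map_add, map_mul, map_mul, ← ha, ← ha', map_pow, map_pow]
      ring
    | single b c =>
      obtain ⟨k, hk⟩ := H b b.2
      refine ⟨k, AddMonoidAlgebra.single ⟨_, hk⟩ c, ?_⟩
      rw [hs, hs, AddMonoidAlgebra.single_pow, AddMonoidAlgebra.single_mul_single]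
      congr 1
      simp
  · intro a b hab
    exact ⟨0, by rw [hinj hab]⟩

lemma exists_add_nsmul_mem {σ τ : PointedCone ℚ (ℚ ⊗[ℤ] N)} (hσ : σ.FG)
    {m : Module.Dual ℤ N} (hm : m ∈ dualMonoid σ)
    (hτ : ∀ x, x ∈ τ ↔ x ∈ σ ∧ pairing m x = 0) :
    ∀ b ∈ dualMonoid τ, ∃ k : ℕ, b + k • m ∈ dualMonoid σ := by
  intro b hb
  obtain ⟨s, hs⟩ := hσ
  have h1 : ∀ x ∈ s, ∃ k : ℕ, ∀ l : ℕ, k ≤ l → 0 ≤ pairing (b + l • m) x := by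
    intro x hx
    have hxσ : x ∈ σ := hs ▸ Submodule.subset_span hx
    have h0 := hm x hxσ
    rcases h0.eq_or_lt with h0 | h0
    · refine ⟨0, fun l _ => ?_⟩
      rw [pairing_add, pairing_nsmul, ← h0, mul_zero, add_zero]
      exact hb x ((hτ x).2 ⟨hxσ, h0.symm⟩)
    · obtain ⟨k, hk⟩ := exists_nat_ge (-pairing b x / pairing m x)
      refine ⟨k, fun l hl => ?_⟩
      rw [pairing_add, pairing_nsmul]
      have : -pairing b x / pairing m x ≤ l := hk.trans (by exact_mod_cast hl)
      rw [div_le_iff₀ h0] at this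
      linarith
  choose! k hk using h1
  refine ⟨s.sup k, fun x hx => ?_⟩
  rw [← hs] at hx
  induction hx using Submodule.span_induction with
  | mem x hx => exact hk x hx _ (Finset.le_sup hx)
  | zero => simp
  | add x y _ _ hx hy => rw [map_add]; exact add_nonneg hx hy
  | smul a x _ hx =>
    have : pairing (b + s.sup k • m) (a • x) = (a : ℚ) * pairing (b + s.sup k • m) x := by
      rw [← smul_eq_mul, ← map_smul]; rfl
    rw [this]
    exact mul_nonneg a.2 hx

/-- For a face `τ = σ ∩ m^⊥`, the algebra `ℂ[S_τ]` is the localization of `ℂ[S_σ]` at `χ^m`. -/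
lemma isLocalization_face {σ τ : PointedCone ℚ (ℚ ⊗[ℤ] N)} (hσ : σ.FG)
    {m : Module.Dual ℤ N} (hm : m ∈ dualMonoid σ)
    (hτ : ∀ x, x ∈ τ ↔ x ∈ σ ∧ pairing m x = 0) (h : τ ≤ σ) :
    let _ := (inclHom (dualMonoid_anti h)).toAlgebra
    IsLocalization.Away (AddMonoidAlgebra.single (⟨m, hm⟩ : dualMonoid σ) (1 : ℂ))
      ℂ[dualMonoid τ] := by
  refine isLocalization_inclHom _ _ ?_ (exists_add_nsmul_mem hσ hm hτ)
  intro x hx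
  rw [pairing_neg, ((hτ x).1 hx).2, neg_zero]

/-! ### The affine toric varieties and their gluing -/

/-- The affine toric variety `U_σ = Spec ℂ[σ^∨ ∩ M]`. -/
abbrev affineChart (σ : PointedCone ℚ (ℚ ⊗[ℤ] N)) : Scheme.{0} :=
  Spec (CommRingCat.of ℂ[dualMonoid σ])

/-- The morphism `U_τ ⟶ U_σ` for `τ ≤ σ`. -/
def affineMap {τ σ : PointedCone ℚ (ℚ ⊗[ℤ] N)} (h : τ ≤ σ) : affineChart τ ⟶ affineChart σ :=
  Spec.map (CommRingCat.ofHom (inclHom (dualMonoid_anti h)))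

lemma isOpenImmersion_affineMap {τ σ : PointedCone ℚ (ℚ ⊗[ℤ] N)} (hσ : σ.FG)
    (hf : IsFace τ σ) (h : τ ≤ σ) : IsOpenImmersion (affineMap h) := by
  obtain ⟨m, hm, hτ⟩ := hf
  let _ := (inclHom (dualMonoid_anti h)).toAlgebra
  have := isLocalization_face hσ hm hτ h
  exact IsOpenImmersion.of_isLocalization (S := ℂ[dualMonoid τ])
    (AddMonoidAlgebra.single (⟨m, hm⟩ : dualMonoid σ) (1 : ℂ))

lemma range_affineMap {τ σ : PointedCone ℚ (ℚ ⊗[ℤ] N)} (hσ : σ.FG)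
    {m : Module.Dual ℤ N} (hm : m ∈ dualMonoid σ)
    (hτ : ∀ x, x ∈ τ ↔ x ∈ σ ∧ pairing m x = 0) (h : τ ≤ σ) :
    Set.range (affineMap h) = (PrimeSpectrum.basicOpen
      (AddMonoidAlgebra.single (⟨m, hm⟩ : dualMonoid σ) (1 : ℂ)) :
        Set (PrimeSpectrum ℂ[dualMonoid σ])) := by
  let _ := (inclHom (dualMonoid_anti h)).toAlgebra
  have := isLocalization_face hσ hm hτ h
  exact PrimeSpectrum.localization_away_comap_range ℂ[dualMonoid τ]
    (AddMonoidAlgebra.single (⟨m, hm⟩ : dualMonoid σ) (1 : ℂ))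

end Toric

namespace Fan

open Toric

variable {N : Type} [AddCommGroup N] (F : Fan N)

lemma isFace_of_le {σ τ : F.cones} (h : τ.1 ≤ σ.1) : IsFace τ.1 σ.1 := by
  have := F.inf_isFace σ.1 σ.2 τ.1 τ.2
  rwa [inf_eq_right.2 h] at this

/-- The diagram of the affine toric varieties `U_σ`, `σ ∈ F`, ordered by inclusion of cones. -/
def diagram : F.cones ⥤ Scheme.{0} where
  obj σ := affineChart σ.1
  map f := affineMap (leOfHom f)
  map_id σ := by
    rw [← Spec.map_id]
    refine congrArg Spec.map (CommRingCat.hom_ext ?_)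
    apply AddMonoidAlgebra.ringHom_ext <;> intro <;> simp [inclHom] <;> rfl
  map_comp f g := by
    refine Eq.trans (congrArg Spec.map (CommRingCat.hom_ext ?_)) (Spec.map_comp _ _)
    apply AddMonoidAlgebra.ringHom_ext <;> intro <;> simp [inclHom] <;> rfl

instance {σ τ : F.cones} (f : σ ⟶ τ) : IsOpenImmersion (F.diagram.map f) :=
  isOpenImmersion_affineMap (F.fg _ τ.2) (F.isFace_of_le (leOfHom f)) (leOfHom f)

instance : (F.diagram ⋙ Scheme.forget).IsLocallyDirected := by
  constructor
  intro i j k fi fj xi xj h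
  have hi := leOfHom fi
  have hj := leOfHom fj
  obtain ⟨m, hm, h1⟩ := F.isFace_of_le hi
  obtain ⟨m', hm', h2⟩ := F.isFace_of_le hj
  have h3 : ∀ x, x ∈ i.1 ⊓ j.1 ↔ x ∈ k.1 ∧ pairing (m + m') x = 0 := by
    intro x
    rw [Submodule.mem_inf, h1, h2, pairing_add]
    constructor
    · rintro ⟨⟨hx, h4⟩, -, h5⟩
      exact ⟨hx, by rw [h4, h5, add_zero]⟩
    · rintro ⟨hx, h4⟩
      have := hm x hx
      have := hm' x hx
      exact ⟨⟨hx, by linarith⟩, hx, by linarith⟩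
  let l : F.cones := ⟨i.1 ⊓ j.1, F.face_mem _ i.2 _ (F.inf_isFace _ i.2 _ j.2)⟩
  have hl : l.1 ≤ k.1 := le_trans inf_le_left hi
  have hz : affineMap hi xi ∈ Set.range (affineMap hl) := by
    have ha : affineMap hi xi ∈ Set.range (affineMap hi) := ⟨_, rfl⟩
    have hb : affineMap hi xi ∈ Set.range (affineMap hj) := ⟨xj, h.symm⟩
    rw [range_affineMap (F.fg _ k.2) hm h1] at ha
    rw [range_affineMap (F.fg _ k.2) hm' h2] at hb
    rw [range_affineMap (F.fg _ k.2) (add_mem hm hm') h3]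
    have hmul : (AddMonoidAlgebra.single (⟨m + m', add_mem hm hm'⟩ : dualMonoid k.1) (1 : ℂ)) =
        AddMonoidAlgebra.single (⟨m, hm⟩ : dualMonoid k.1) (1 : ℂ) *
        AddMonoidAlgebra.single (⟨m', hm'⟩ : dualMonoid k.1) (1 : ℂ) := by
      rw [AddMonoidAlgebra.single_mul_single, one_mul]; rfl
    rw [hmul, PrimeSpectrum.basicOpen_mul]
    exact ⟨ha, hb⟩
  obtain ⟨z, hz⟩ := hz
  let fli : l ⟶ i := homOfLE (inf_le_left : i.1 ⊓ j.1 ≤ i.1)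
  let flj : l ⟶ j := homOfLE (inf_le_right : i.1 ⊓ j.1 ≤ j.1)
  refine ⟨l, fli, flj, z, ?_, ?_⟩
  · apply (F.diagram.map fi).isOpenEmbedding.injective
    refine Eq.trans ?_ hz
    exact (congrArg (fun f => f z) (F.diagram.map_comp fli fi)).symm
  · apply (F.diagram.map fj).isOpenEmbedding.injective
    refine Eq.trans ?_ (hz.trans h)
    exact (congrArg (fun f => f z) (F.diagram.map_comp flj fj)).symm

/-- The toric variety `X_F`, glued from the affine toric varieties `U_σ`, `σ ∈ F`, along the
open immersions `U_τ ⟶ U_σ` for the faces `τ` of `σ`. -/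
def toricVariety : Scheme.{0} := Limits.colimit F.diagram

/-- The open immersion `U_σ ⟶ X_F`. -/
def chart (σ : F.cones) : affineChart σ.1 ⟶ F.toricVariety := Limits.colimit.ι F.diagram σ

instance (σ : F.cones) : IsOpenImmersion (F.chart σ) :=
  inferInstanceAs (IsOpenImmersion (Limits.colimit.ι F.diagram σ))

/-- The structure morphism `X_F ⟶ Spec ℂ`. -/
def structureMap : F.toricVariety ⟶ Spec (CommRingCat.of ℂ) :=
  Limits.colimit.desc F.diagram
    { pt := Spec (CommRingCat.of ℂ)
      ι :=
        { app := fun σ => Spec.map (CommRingCat.ofHom (algebraMap ℂ ℂ[dualMonoid σ.1]))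
          naturality := fun σ τ f => by
            refine Eq.trans ?_ (Category.comp_id _).symm
            refine (Spec.map_comp _ _).symm.trans
              (congrArg Spec.map (CommRingCat.hom_ext ?_))
            exact AddMonoidAlgebra.mapDomainRingHom_comp_algebraMap _ } }

/-! ### Rays and torus invariant prime divisors -/

/-- The rays `ρ` of the fan, given by their primitive generators `u_ρ ∈ N`. -/
def rays : Set N := {u | IsPrimitive u ∧ rayCone u ∈ F.cones}

/-- The ray `ρ` as a cone of the fan. -/
def rayOf (ρ : F.rays) : F.cones := ⟨rayCone ρ.1, ρ.2.2⟩

/-- The set `σ(1)` of the rays of a cone `σ` of the fan. -/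
def raysIn (σ : F.cones) : Set F.rays := {ρ | vec ρ.1 ∈ σ.1}

end Fan

namespace Toric

variable {N : Type} [AddCommGroup N]

lemma mem_rayCone {u : N} {x : ℚ ⊗[ℤ] N} :
    x ∈ rayCone u ↔ ∃ q : ℚ, 0 ≤ q ∧ x = q • vec u := by
  rw [rayCone, PointedCone.hull, Submodule.mem_span_singleton]
  constructor
  · rintro ⟨q, rfl⟩
    exact ⟨q.1, q.2, rfl⟩
  · rintro ⟨q, hq, rfl⟩
    exact ⟨⟨q, hq⟩, rfl⟩

lemma eq_of_rayCone_eq [Module.Free ℤ N] {u w : N} (hu : IsPrimitive u) (hw : IsPrimitive w)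
    (h : rayCone u = rayCone w) : u = w := by
  have h1 : vec u ∈ rayCone w := h ▸ mem_rayCone.2 ⟨1, by simp, by simp⟩
  obtain ⟨q, hq, h1⟩ := mem_rayCone.1 h1
  have h2 : (q.den : ℤ) • u = q.num • w := by
    rw [← sub_eq_zero, ← Module.forall_dual_apply_eq_zero_iff ℤ]
    intro m
    have h3 : pairing m (vec u) = q * pairing m (vec w) := by rw [h1, map_smul, smul_eq_mul]
    rw [pairing_vec, pairing_vec] at h3
    have h4 : (q.den : ℚ) * (m u : ℚ) = q.num * m w := by
      rw [h3, ← mul_assoc, mul_comm (q.den : ℚ) q, Rat.mul_den_eq_num]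
    rw [map_sub, map_smul, map_smul, smul_eq_mul, smul_eq_mul, sub_eq_zero]
    exact_mod_cast h4
  obtain ⟨x, y, hxy⟩ := (Int.isCoprime_iff_gcd_eq_one.2
    (by simpa [Int.gcd, Nat.Coprime] using q.reduced) : IsCoprime q.num (q.den : ℤ))
  have h5 : u = q.num • (x • u + y • w) := by
    calc u = (x * q.num + y * q.den) • u := by rw [hxy, one_smul]
      _ = q.num • (x • u) + y • ((q.den : ℤ) • u) := by module
      _ = _ := by rw [h2]; module
  have h6 : w = (q.den : ℤ) • (x • u + y • w) := by
    calc w = (x * q.num + y * q.den) • w := by rw [hxy, one_smul]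
      _ = x • (q.num • w) + (q.den : ℤ) • (y • w) := by module
      _ = _ := by rw [← h2]; module
  have h7 : q.num = 1 := by
    have := Rat.num_nonneg.2 hq
    rcases Int.isUnit_iff.1 (hu _ _ h5) with h | h <;> omega
  have h8 : (q.den : ℤ) = 1 := by
    rcases Int.isUnit_iff.1 (hw _ _ h6) with h | h <;> omega
  rw [h5, h7]
  nth_rw 2 [h6]
  rw [h8]

end Toric

namespace Fan

open Toric

variable {N : Type} [AddCommGroup N] (F : Fan N)

instance [Module.Free ℤ N] : Finite F.rays := by
  have := F.finite.to_subtype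
  refine Finite.of_injective F.rayOf fun ρ ρ' h => Subtype.ext ?_
  exact eq_of_rayCone_eq ρ.2.1 ρ'.2.1 (congrArg Subtype.val h)

instance [Module.Free ℤ N] : Fintype F.rays := Fintype.ofFinite _

end Fan

namespace Toric

variable {N : Type} [AddCommGroup N]

/-- Restriction of functions on `U_ρ`, `ρ = ℚ_{≥0} u`, to the orbit closure `O(ρ) ⊆ U_ρ`: it sends
`χ^m` to `χ^m` if `⟨m, u⟩ = 0` and to `0` if `⟨m, u⟩ > 0`. -/
def orbitHom (u : N) : ℂ[dualMonoid (rayCone u)] →ₐ[ℂ] ℂ[Module.Dual ℤ N] :=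
  open Classical in
  AddMonoidAlgebra.lift ℂ _ _
    { toFun := fun m => if (m.toAdd : Module.Dual ℤ N) u = 0
        then AddMonoidAlgebra.single (m.toAdd : Module.Dual ℤ N) 1 else 0
      map_one' := by simp [AddMonoidAlgebra.one_def]
      map_mul' := fun m m' => by
        have h : ∀ m : dualMonoid (rayCone u), 0 ≤ (m : Module.Dual ℤ N) u := fun m => by
          have := m.2 (vec u) (mem_rayCone.2 ⟨1, by simp, by simp⟩)
          rw [pairing_vec] at this
          exact_mod_cast this
        have h1 := h m.toAdd
        have h2 := h m'.toAdd
        by_cases h3 : (m.toAdd : Module.Dual ℤ N) u = 0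
        · by_cases h4 : (m'.toAdd : Module.Dual ℤ N) u = 0
          · simp [h3, h4, AddMonoidAlgebra.single_mul_single]
          · simp [h3, h4]
        · have h4 : ¬ (m.toAdd : Module.Dual ℤ N) u + (m'.toAdd : Module.Dual ℤ N) u = 0 := by
            omega
          simp [h3, h4] }

variable [Module.Free ℤ N] [Module.Finite ℤ N]

instance : IsDomain ℂ[Module.Dual ℤ N] := by
  have : AddMonoid.FG (Module.Dual ℤ N) := by
    rw [← AddGroup.fg_iff_addMonoid_fg, ← Module.Finite.iff_addGroup_fg]
    infer_instance
  have : IsAddTorsionFree (Module.Dual ℤ N) := ⟨fun n hn χ χ' h => by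
    ext v
    have h1 := LinearMap.congr_fun h v
    simpa [hn] using h1⟩
  infer_instance

end Toric

namespace Fan

open Toric

variable {N : Type} [AddCommGroup N] [Module.Free ℤ N] [Module.Finite ℤ N] (F : Fan N)

/-- The torus invariant prime divisor `D_ρ`, given by its generic point: this is the generic point
of the orbit `O(ρ)`, that is, the prime ideal of `ℂ[S_ρ]` spanned by the characters `χ^m` with
`⟨m, u_ρ⟩ > 0`. -/
def divisor (ρ : F.rays) : F.toricVariety :=
  F.chart (F.rayOf ρ) (PrimeSpectrum.comap (orbitHom ρ.1).toRingHom ⊥ :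
    PrimeSpectrum ℂ[dualMonoid (rayCone ρ.1)])

/-- The toric boundary `Δ = ∑_ρ (1 - 1 / m_ρ) D_ρ` with standard coefficients, as a
`ℚ`-combination of (generic points of) prime divisors. -/
def boundary (m : F.rays → ℕ) : F.toricVariety →₀ ℚ :=
  ∑ ρ, Finsupp.single (F.divisor ρ) (1 - 1 / (m ρ : ℚ))

end Fan

/-! ### `ℚ`-factorial schemes and orbifold pairs -/

/-- A (normal, integral) scheme is `ℚ`-factorial if every prime divisor `D` has a multiple `n D`,
`n > 0`, that is Cartier: every point `p` has a neighbourhood on which there is a function `f`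
with `div f = n D`. A prime divisor is given by its generic point `x`, a point of codimension one;
`f` has order `n` at a point `y` of codimension one if it generates the `n`-th power of the
maximal ideal of the discrete valuation ring `𝒪_y`. -/
def IsQFactorial (X : Scheme.{0}) : Prop :=
  ∀ x : X, Order.coheight x = 1 → ∃ n : ℕ, 0 < n ∧
    ∀ p : X, ∃ (W : X.Opens) (_ : p ∈ W) (f : Γ(X, W)),
      ∀ (y : X) (hy : y ∈ W), Order.coheight y = 1 →
        (y = x → Ideal.span {X.presheaf.germ W y hy f} =
          IsLocalRing.maximalIdeal (X.presheaf.stalk y) ^ n) ∧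
        (y ≠ x → IsUnit (X.presheaf.germ W y hy f))

/-- The morphism `π : V ⟶ X` has ramification index `e` at `y`:
`𝔪_{π y} 𝒪_y = 𝔪_y ^ e`. -/
def HasRamificationIndex {V X : Scheme.{0}} (π : V ⟶ X) (y : V) (e : ℕ) : Prop :=
  Ideal.map (π.stalkMap y).hom (IsLocalRing.maximalIdeal (X.presheaf.stalk (π y))) =
    IsLocalRing.maximalIdeal (V.presheaf.stalk y) ^ e

/-- The ring of invariants `B^G` of a group acting on a `ℂ`-algebra. -/
def invariants {B : Type} [CommRing B] [Algebra ℂ B] {G : Type} [Group G]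
    (act : G →* (B →ₐ[ℂ] B)) : Subalgebra ℂ B :=
  ⨅ g : G, AlgHom.equalizer (act g) (AlgHom.id ℂ B)

/-- An orbifold chart of the pair `(X, Δ)`: a smooth connected affine variety `V = Spec B` with a
faithful action of a finite group `G`, and a morphism `π : V ⟶ X` over `ℂ` that identifies `V / G`
with an open subscheme of `X` and whose branch divisor is `Δ`: for every prime divisor of
`V`, with generic point `y`, the ramification index `e` of `π` along it satisfies that `Δ` has
coefficient `1 - 1 / e` at the image of that prime divisor. -/
structure IsOrbifoldChart {X : Scheme.{0}} (s : X ⟶ Spec (CommRingCat.of ℂ)) (Δ : X →₀ ℚ)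
    {B : Type} [CommRing B] [Algebra ℂ B] {G : Type} [Group G]
    (act : G →* (B →ₐ[ℂ] B)) (π : Spec (CommRingCat.of B) ⟶ X) : Prop where
  isDomain : IsDomain B
  smooth : Algebra.Smooth ℂ B
  finite : Finite G
  faithful : Function.Injective act
  comp_eq : π ≫ s = Spec.map (CommRingCat.ofHom (algebraMap ℂ B))
  quotient : ∃ j : Spec (CommRingCat.of (invariants act)) ⟶ X, IsOpenImmersion j ∧
    Spec.map (CommRingCat.ofHom (invariants act).val.toRingHom) ≫ j = π
  ramification : ∀ y : Spec (CommRingCat.of B), Order.coheight y = 1 →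
    ∃ e : ℕ, 0 < e ∧ HasRamificationIndex π y e ∧ Δ (π y) = 1 - 1 / (e : ℚ)

/-- The pair `(X, Δ)` is an orbifold: locally it is the quotient of a smooth variety by a finite
group, with branch divisor `Δ`. -/
def IsOrbifold {X : Scheme.{0}} (s : X ⟶ Spec (CommRingCat.of ℂ)) (Δ : X →₀ ℚ) : Prop :=
  ∀ x : X, ∃ (B : Type) (_ : CommRing B) (_ : Algebra ℂ B) (G : Type) (_ : Group G)
    (act : G →* (B →ₐ[ℂ] B)) (π : Spec (CommRingCat.of B) ⟶ X),
    IsOrbifoldChart s Δ act π ∧ x ∈ Set.range π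

/-! ### The log Cox construction of a chart -/

namespace Fan

open Toric

variable {N : Type} [AddCommGroup N] (F : Fan N) (m : F.rays → ℕ) (σ : F.cones) {J : Type}
  (w : J → N)

/-- The lattice vectors `m_ρ u_ρ`, `ρ ∈ σ(1)`, together with further vectors `w_j` (none, if `σ`
is full-dimensional), define a lattice homomorphism `P : ℤ^{σ(1)} ⊕ ℤ^J → N` with `e_ρ ↦ m_ρ u_ρ`
and `e_j ↦ w_j`. This is its dual `P^* : M → ℤ^{σ(1)} ⊕ ℤ^J`. -/
def coxMap : Module.Dual ℤ N →+ (F.raysIn σ → ℤ) × (J → ℤ) where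
  toFun χ := (fun ρ => χ ((m ρ.1 : ℤ) • ρ.1.1), fun j => χ (w j))
  map_zero' := by ext <;> simp
  map_add' χ χ' := by ext <;> simp

/-- The cokernel of `P^*`: the (local) log class group. -/
abbrev LogClassGroup : Type := ((F.raysIn σ → ℤ) × (J → ℤ)) ⧸ (F.coxMap m σ w).range

variable (J) in
/-- The (local) log Cox ring `ℂ[x_ρ, t_j^{±1} : ρ ∈ σ(1), j ∈ J]`, written as the algebra of the
monoid of the exponents of its monomials. -/
abbrev coxRing : Type := ℂ[(F.raysIn σ → ℕ) × (J → ℤ)]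

/-- The degree of the monomials of the log Cox ring in the log class group. -/
def coxDegree : (F.raysIn σ → ℕ) × (J → ℤ) →+ F.LogClassGroup m σ w where
  toFun a := QuotientAddGroup.mk (fun ρ => (a.1 ρ : ℤ), a.2)
  map_zero' := rfl
  map_add' a b := by
    rw [← QuotientAddGroup.mk_add]
    refine congrArg _ (Prod.ext (funext fun ρ => ?_) rfl)
    simp

/-- The group `H = Hom(Cl, ℂ^×)` of characters of the log class group. -/
abbrev coxGroup : Type := AddChar (F.LogClassGroup m σ w) ℂ

/-- The action of `H` on the log Cox ring that is given by the grading: `g ∈ H` multiplies a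
monomial of degree `d` with `g(d)`. -/
def coxAction : F.coxGroup m σ w →* (F.coxRing σ J →ₐ[ℂ] F.coxRing σ J) where
  toFun g := AddMonoidAlgebra.lift ℂ _ _
    { toFun := fun a => AddMonoidAlgebra.single a.toAdd (g (F.coxDegree m σ w a.toAdd))
      map_one' := by simp [AddMonoidAlgebra.one_def]
      map_mul' := fun a b => by
        simp [AddMonoidAlgebra.single_mul_single, AddChar.map_add_eq_mul] }
  map_one' := by
    refine AddMonoidAlgebra.algHom_ext (fun a => ?_) (Subsingleton.elim _ _)
    simp
  map_mul' g h := by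
    refine AddMonoidAlgebra.algHom_ext (fun a => ?_) (Subsingleton.elim _ _)
    simp [mul_comm]

lemma apply_nonneg_of_mem_raysIn (χ : dualMonoid σ.1) (ρ : F.raysIn σ) :
    0 ≤ (χ : Module.Dual ℤ N) ((m ρ.1 : ℤ) • ρ.1.1) := by
  have := χ.2 _ ρ.2
  rw [pairing_vec] at this
  rw [map_smul, smul_eq_mul]
  exact mul_nonneg (by positivity) (by exact_mod_cast this)

/-- The homomorphism from `ℂ[S_σ]` to the log Cox ring with
`χ^m ↦ ∏_ρ x_ρ ^ (m_ρ ⟨m, u_ρ⟩) ∏_j t_j ^ ⟨m, w_j⟩`. The first exponents are nonnegative, so that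
`Int.toNat` does not change them. -/
def coxHom : ℂ[dualMonoid σ.1] →+* F.coxRing σ J :=
  AddMonoidAlgebra.mapDomainRingHom ℂ
    { toFun := fun χ => (fun ρ => ((F.coxMap m σ w χ).1 ρ).toNat, (F.coxMap m σ w χ).2)
      map_zero' := by ext <;> simp
      map_add' := fun χ χ' => by
        ext ρ
        · have h := F.apply_nonneg_of_mem_raysIn m σ χ ρ
          have h' := F.apply_nonneg_of_mem_raysIn m σ χ' ρ
          simp only [AddSubmonoid.coe_add, map_add]
          exact Int.toNat_add h h'
        · simp }

/-- The log Cox construction `Spec ℂ[x_ρ, t_j^{±1}] ⟶ U_σ ⊆ X_F`: the toric morphism given by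
the lattice homomorphism `P`. -/
def coxMorphism : Spec (CommRingCat.of (F.coxRing σ J)) ⟶ F.toricVariety :=
  Spec.map (CommRingCat.ofHom (F.coxHom m σ w)) ≫ F.chart σ

end Fan

end

/-! `ℚ`-factoriality is used only to show that the cones are simplicial (`linearIndependent_rays`).
The rest is a computation with exponents of monomials.

Let `ρ` be a ray of `σ`, not the only one. Near the generic point `p` of the minimal orbit of `U_σ`,
a multiple of `D_ρ` is given, up to a unit, by some `a ∈ ℂ[S_σ]`. It vanishes along `D_ρ`, along no
other `D_ρ'`, and along no divisor of the torus whose closure contains `p`. By Krull's theorem `a`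
then divides, on the torus, a function `c` with `c(p) ≠ 0`, say `a h = c` (`exists_local_equation`).
Compare lowest terms: in the direction of an interior vector of `σ`, those of `a` and `h` multiply
to a term of `c` whose exponent vanishes on `σ`. Minimality in the direction of each `u_ρ'` then
forces the exponent of this lowest term of `a` to vanish on every ray except `ρ`
(`exists_dual_separating_ray`). Characters that separate the rays make them independent.

Over `ℚ` the map `P` is now an isomorphism, so `P^*` is injective and some `K > 0` kills its
cokernel. Hence `H` is finite and the `K`-th power of every monomial comes from `ℂ[S_σ]`. Characters
of `H` separate degrees, so the invariants are spanned by the monomials of degree zero. Their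
exponents are the `P^* χ` with `χ ≥ 0` on the rays of `σ`, which means `χ ∈ S_σ`, because `σ` is
generated by its rays (`cone_eq_hull_rays`, a consequence of Gordan's theorem). So `V / H = U_σ`
(`range_coxHom`).

A prime of height one in the log Cox ring either contains some `x_ρ`, and then equals `(x_ρ)`, or
contains no monomial. At `(x_ρ)` the character `χ` pulls back to `x_ρ ^ (m_ρ ⟨χ, u_ρ⟩)` times a
unit, and on a simplicial cone the value `⟨χ, u_ρ⟩ = 1` is attained in `S_σ`: the index is `m_ρ`. At
a prime without monomials every monomial `s` is a unit with `s ^ K` from below, so `K s ^ (K - 1) ds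
= 0` kills all relative differentials and the index is `1`. Since `(x_ρ)` is the only prime over
`D_ρ`, the boundary has coefficient `0` at the images of the primes of the second kind. -/

noncomputable section

/-! ### Gordan's theorem and generators of polyhedral cones -/

namespace Toric

/-- Gordan's theorem: finitely many vectors either lie in a common open half space or satisfy a
nontrivial relation with nonnegative coefficients. -/
theorem exists_forall_pos_or_exists_relation {ι : Type} (s : Finset ι) :
    ∀ {V : Type} [AddCommGroup V] [Module ℚ V] (v : ι → V),
      (∃ φ : V →ₗ[ℚ] ℚ, ∀ i ∈ s, 0 < φ (v i)) ∨
      ∃ c : ι → ℚ, (∀ i ∈ s, 0 ≤ c i) ∧ (∃ i ∈ s, c i ≠ 0) ∧ ∑ i ∈ s, c i • v i = 0 := by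
  classical
  induction s using Finset.induction_on with
  | empty => intro V _ _ v; exact Or.inl ⟨0, by simp⟩
  | insert a s ha ih =>
    intro V _ _ v
    have update_sum : ∀ (c : ι → ℚ) (q : ℚ), ∑ i ∈ insert a s, Function.update c a q i • v i =
        q • v a + ∑ i ∈ s, c i • v i := fun c q => by
      rw [Finset.sum_insert ha, Function.update_self]
      refine congrArg _ (Finset.sum_congr rfl fun i hi => ?_)
      rw [Function.update_of_ne (ne_of_mem_of_not_mem hi ha)]
    have update_nonneg : ∀ (c : ι → ℚ) (q : ℚ), (∀ i ∈ s, 0 ≤ c i) → 0 ≤ q →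
        ∀ i ∈ insert a s, 0 ≤ Function.update c a q i := fun c q hc hq i hi => by
      by_cases h : i = a
      · subst h; rwa [Function.update_self]
      · rw [Function.update_of_ne h]; exact hc i (Finset.mem_of_mem_insert_of_ne hi h)
    have update_ne : ∀ (c : ι → ℚ) (q : ℚ), (∃ i ∈ s, c i ≠ 0) →
        ∃ i ∈ insert a s, Function.update c a q i ≠ 0 := fun c q ⟨i, hi, h⟩ =>
      ⟨i, Finset.mem_insert_of_mem hi, by
        rwa [Function.update_of_ne (ne_of_mem_of_not_mem hi ha)]⟩
    by_cases h0 : v a = 0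
    · refine Or.inr ⟨Function.update 0 a 1, update_nonneg _ _ (by simp) zero_le_one,
        ⟨a, Finset.mem_insert_self _ _, by simp⟩, ?_⟩
      rw [update_sum, h0]
      simp
    -- Pass to the quotient by the line of `v a`. This is why the induction runs over all spaces
    -- `V`.
    rcases ih (fun i => (Submodule.span ℚ {v a}).mkQ (v i)) with ⟨φ, hφ⟩ | ⟨c, hc, hc', hcs⟩
    · obtain ⟨ψ, hψ⟩ : ∃ ψ : V →ₗ[ℚ] ℚ, 0 < ψ (v a) := by
        by_contra! h
        refine h0 ((Module.forall_dual_apply_eq_zero_iff ℚ (v a)).1 fun χ => ?_)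
        have h1 := h χ
        have h2 := h (-χ)
        simp only [LinearMap.neg_apply] at h2
        linarith
      set φ' := φ ∘ₗ (Submodule.span ℚ {v a}).mkQ
      have hφa : φ' (v a) = 0 := by
        have : (Submodule.span ℚ {v a}).mkQ (v a) = 0 := by
          simp
        simp only [φ', LinearMap.comp_apply, this, map_zero]
      have hC : ∀ i ∈ s, ∃ C : ℕ, ∀ D : ℕ, C ≤ D → 0 < D * φ' (v i) + ψ (v i) := by
        intro i hi
        have hp : 0 < φ' (v i) := hφ i hi
        obtain ⟨C, hC⟩ := exists_nat_gt (-ψ (v i) / φ' (v i))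
        refine ⟨C, fun D hD => ?_⟩
        have : -ψ (v i) / φ' (v i) < D := hC.trans_le (by exact_mod_cast hD)
        rw [div_lt_iff₀ hp] at this
        linarith
      choose! C hC using hC
      -- `φ'` is positive on `s` but zero at `v a`, so a large multiple of it is corrected by `ψ`.
      refine Or.inl ⟨((s.sup C : ℕ) : ℚ) • φ' + ψ, fun i hi => ?_⟩
      rw [LinearMap.add_apply, LinearMap.smul_apply, smul_eq_mul]
      rcases Finset.mem_insert.1 hi with rfl | hi
      · rw [hφa, mul_zero, zero_add]; exact hψ
      · exact hC i hi _ (Finset.le_sup hi)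
    · have hmem : ∑ i ∈ s, c i • v i ∈ Submodule.span ℚ {v a} := by
        rw [← Submodule.Quotient.mk_eq_zero, ← Submodule.mkQ_apply, map_sum]
        simpa using hcs
      obtain ⟨q, hq⟩ := Submodule.mem_span_singleton.1 hmem
      -- The relation modulo the line lifts to `∑ c i • v i = q • v a`. For `q ≤ 0` this is already
      -- a nonnegative relation. For `q > 0` a functional positive on `s` is positive at `v a` as
      -- well.
      rcases le_or_gt q 0 with hq0 | hq0
      · refine Or.inr ⟨Function.update c a (-q), update_nonneg _ _ hc (by linarith),
          update_ne _ _ hc', ?_⟩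
        rw [update_sum, ← hq]
        simp
      · rcases ih v with ⟨φ, hφ⟩ | ⟨c, hc, hc', hcs⟩
        · refine Or.inl ⟨φ, fun i hi => ?_⟩
          rcases Finset.mem_insert.1 hi with rfl | hi
          · have h1 : q * φ (v i) = ∑ j ∈ s, c j * φ (v j) := by
              have := congrArg φ hq
              simpa using this
            obtain ⟨j, hj, hj'⟩ := hc'
            have h2 : 0 < ∑ j ∈ s, c j * φ (v j) :=
              Finset.sum_pos' (fun k hk => mul_nonneg (hc k hk) (hφ k hk).le)
                ⟨j, hj, mul_pos (lt_of_le_of_ne (hc j hj) (Ne.symm hj')) (hφ j hj)⟩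
            rw [← h1] at h2
            exact (mul_pos_iff_of_pos_left hq0).1 h2
          · exact hφ i hi
        · refine Or.inr ⟨Function.update c a 0, update_nonneg _ _ hc le_rfl, update_ne _ _ hc', ?_⟩
          rw [update_sum, hcs]
          simp

section Cone

variable {V : Type} [AddCommGroup V] [Module ℚ V]

lemma sum_smul_mem_cone {ι : Type} {C : PointedCone ℚ V} {s : Finset ι} {c : ι → ℚ} {v : ι → V}
    (hc : ∀ i ∈ s, 0 ≤ c i) (hv : ∀ i ∈ s, v i ∈ C) : ∑ i ∈ s, c i • v i ∈ C :=
  Submodule.sum_mem _ fun i hi => Submodule.smul_mem C (⟨c i, hc i hi⟩ : {q : ℚ // 0 ≤ q}) (hv i hi)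

lemma smul_mem_cone {C : PointedCone ℚ V} {c : ℚ} (hc : 0 ≤ c) {x : V} (hx : x ∈ C) : c • x ∈ C :=
  Submodule.smul_mem C (⟨c, hc⟩ : {q : ℚ // 0 ≤ q}) hx

lemma exists_sum_of_mem_hull {s : Finset V} {x : V} (hx : x ∈ PointedCone.hull ℚ (s : Set V)) :
    ∃ c : V → ℚ, (∀ v, 0 ≤ c v) ∧ ∑ v ∈ s, c v • v = x := by
  obtain ⟨c, -, hc⟩ := Submodule.mem_span_finset.1 hx
  exact ⟨fun v => (c v).1, fun v => (c v).2, hc⟩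

lemma exists_irredundant_generators {C : PointedCone ℚ V} (hC : C.FG) :
    ∃ s : Finset V, PointedCone.hull ℚ (s : Set V) = C ∧
      ∀ v ∈ s, v ∉ PointedCone.hull ℚ ((s : Set V) \ {v}) := by
  classical
  obtain ⟨s, hs⟩ := hC
  induction s using Finset.strongInduction with
  | H s ih =>
    by_cases h : ∃ v ∈ s, v ∈ PointedCone.hull ℚ ((s : Set V) \ {v})
    · obtain ⟨v, hv, hv'⟩ := h
      rw [← Finset.coe_erase] at hv'
      refine ih _ (Finset.erase_ssubset hv) ?_
      rw [← hs]
      refine le_antisymm (Submodule.span_mono (by simp)) (Submodule.span_le.2 fun w hw => ?_)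
      by_cases hwv : w = v
      · subst hwv; exact hv'
      · exact Submodule.subset_span (by simpa [hwv] using hw)
    · push Not at h
      exact ⟨s, hs, h⟩

/-- By Gordan's theorem the only obstruction is a nontrivial nonnegative relation, which would put
both `c v • v` and its negative into the cone. -/
lemma exists_pos_on_generators {C : PointedCone ℚ V} (hsal : ∀ x ∈ C, -x ∈ C → x = 0)
    {s : Finset V} (hs : PointedCone.hull ℚ (s : Set V) = C) (h0 : (0 : V) ∉ s) :
    ∃ φ : V →ₗ[ℚ] ℚ, ∀ v ∈ s, 0 < φ v := by
  classical
  refine (exists_forall_pos_or_exists_relation s (fun v => v)).resolve_right ?_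
  rintro ⟨c, hc, ⟨v, hv, hv'⟩, h⟩
  have hsC : ∀ w ∈ s, w ∈ C := fun w hw => hs ▸ Submodule.subset_span hw
  rw [← Finset.add_sum_erase _ _ hv] at h
  have hvC : c v • v ∈ C := smul_mem_cone (hc v hv) (hsC v hv)
  have : c v • v = 0 := by
    refine hsal _ hvC ?_
    rw [neg_eq_of_add_eq_zero_right h]
    exact sum_smul_mem_cone (fun w hw => hc w (Finset.mem_of_mem_erase hw))
      fun w hw => hsC w (Finset.mem_of_mem_erase hw)
  rcases smul_eq_zero.1 this with h | h
  · exact hv' h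
  · exact h0 (h ▸ hv)

/-- An irredundant generator of a salient polyhedral cone spans an exposed ray. -/
lemma exists_supporting_of_irredundant {C : PointedCone ℚ V} (hsal : ∀ x ∈ C, -x ∈ C → x = 0)
    {s : Finset V} (hs : PointedCone.hull ℚ (s : Set V) = C)
    (hirr : ∀ v ∈ s, v ∉ PointedCone.hull ℚ ((s : Set V) \ {v}))
    {v : V} (hv : v ∈ s) :
    ∃ φ : V →ₗ[ℚ] ℚ, φ v = 0 ∧ ∀ w ∈ s, w ≠ v → 0 < φ w := by
  classical
  simp only [← Finset.coe_erase] at hirr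
  have hsC : ∀ w ∈ s, w ∈ C := fun w hw => hs ▸ Submodule.subset_span hw
  have h0 : ∀ w ∈ s, w ≠ 0 := fun w hw h => hirr w hw (h ▸ zero_mem _)
  -- Gordan's theorem modulo the line of `v`. A relation there reads `∑ c w • w = q • v`. If `q >
  -- 0`, then `v` is redundant; if `q ≤ 0`, the cone contains a nonzero vector together with its
  -- negative.
  rcases exists_forall_pos_or_exists_relation (s.erase v)
    (fun w => (Submodule.span ℚ {v}).mkQ w) with ⟨φ, hφ⟩ | ⟨c, hc, ⟨w, hw, hw'⟩, h⟩
  · refine ⟨φ ∘ₗ (Submodule.span ℚ {v}).mkQ, ?_,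
      fun w hw hwv => hφ w (Finset.mem_erase.2 ⟨hwv, hw⟩)⟩
    have : (Submodule.span ℚ {v}).mkQ v = 0 := by
      simp
    rw [LinearMap.comp_apply, this, map_zero]
  · exfalso
    have hmem : ∑ w ∈ s.erase v, c w • w ∈ Submodule.span ℚ {v} := by
      rw [← Submodule.Quotient.mk_eq_zero, ← Submodule.mkQ_apply, map_sum]
      simpa using h
    obtain ⟨q, hq⟩ := Submodule.mem_span_singleton.1 hmem
    rcases lt_or_ge 0 q with hq0 | hq0
    · refine hirr v hv ?_
      have hmem' : ∑ w ∈ s.erase v, c w • w ∈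
          PointedCone.hull ℚ ((s.erase v : Finset V) : Set V) :=
        sum_smul_mem_cone hc fun w hw => Submodule.subset_span hw
      have hv' : v = q⁻¹ • ∑ w ∈ s.erase v, c w • w := by
        rw [← hq, smul_smul, inv_mul_cancel₀ hq0.ne', one_smul]
      have := smul_mem_cone (inv_nonneg.2 hq0.le) hmem'
      rwa [← hv'] at this
    · rw [← Finset.add_sum_erase _ _ hw] at hq
      have hwC : c w • w ∈ C := smul_mem_cone (hc w hw) (hsC w (Finset.mem_of_mem_erase hw))
      have : c w • w = 0 := by
        refine hsal _ hwC ?_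
        have : -(c w • w) = (-q) • v + ∑ x ∈ (s.erase v).erase w, c x • x := by
          rw [neg_smul, hq]; abel
        rw [this]
        refine add_mem (smul_mem_cone (by linarith) (hsC v hv)) (sum_smul_mem_cone
          (fun x hx => hc x (Finset.mem_of_mem_erase hx))
          fun x hx => hsC x (Finset.mem_of_mem_erase (Finset.mem_of_mem_erase hx)))
      rcases smul_eq_zero.1 this with h | h
      · exact hw' h
      · exact h0 w (Finset.mem_of_mem_erase hw) h

end Cone

/-! ### Clearing denominators and primitive vectors -/

section Lattice

variable {N : Type} [AddCommGroup N]

lemma vec_add (v w : N) : vec (v + w) = vec v + vec w := TensorProduct.tmul_add ..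

lemma vec_zsmul (k : ℤ) (v : N) : vec (k • v) = (k : ℚ) • vec v := by
  rw [vec, ← TensorProduct.smul_tmul, vec, TensorProduct.smul_tmul', smul_eq_mul, mul_one]
  simp

lemma exists_vec_smul (x : ℚ ⊗[ℤ] N) : ∃ (k : ℕ) (v : N), 0 < k ∧ vec v = (k : ℚ) • x := by
  induction x with
  | zero => exact ⟨1, 0, one_pos, by simp [vec]⟩
  | add x y hx hy =>
    obtain ⟨k, v, hk, hv⟩ := hx
    obtain ⟨l, w, hl, hw⟩ := hy
    refine ⟨k * l, (l : ℤ) • v + (k : ℤ) • w, Nat.mul_pos hk hl, ?_⟩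
    rw [vec_add, vec_zsmul, vec_zsmul, hv, hw]
    push_cast
    module
  | tmul q v =>
    refine ⟨q.den, q.num • v, q.den_pos, ?_⟩
    have : q ⊗ₜ[ℤ] v = q • vec v := by rw [vec, TensorProduct.smul_tmul', smul_eq_mul, mul_one]
    rw [this, vec_zsmul, smul_smul, Rat.den_mul_eq_num]

variable [Module.Free ℤ N] [Module.Finite ℤ N]

/-- Multiplying by the denominators of the values on a lattice basis makes a rational functional
integral, as `IsFace` requires. -/
lemma exists_pairing_eq_smul (φ : ℚ ⊗[ℤ] N →ₗ[ℚ] ℚ) :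
    ∃ (k : ℕ) (m : Module.Dual ℤ N), 0 < k ∧ ∀ x, pairing m x = k * φ x := by
  let b := Module.Free.chooseBasis ℤ N
  let k : ℕ := ∏ i, (φ (vec (b i))).den
  have hk : ∀ i, ∃ z : ℤ, (z : ℚ) = k * φ (vec (b i)) := fun i => by
    refine ⟨(∏ j ∈ Finset.univ.erase i, (φ (vec (b j))).den : ℕ) * (φ (vec (b i))).num, ?_⟩
    simp only [k]
    rw [← Finset.prod_erase_mul _ _ (Finset.mem_univ i)]
    push_cast
    rw [mul_assoc, Rat.den_mul_eq_num]
  choose z hz using hk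
  refine ⟨k, b.constr ℤ z, Finset.prod_pos fun i _ => Rat.den_pos _, fun x => ?_⟩
  have h1 : ∀ v : N, ((b.constr ℤ z v : ℤ) : ℚ) = k * φ (vec v) := by
    intro v
    have : (Int.castAddHom ℚ).toIntLinearMap ∘ₗ (b.constr ℤ z) =
        (k : ℤ) • (φ.restrictScalars ℤ ∘ₗ TensorProduct.mk ℤ ℚ N 1) := by
      refine b.ext fun i => ?_
      have h2 : b.constr ℤ z (b i) = z i := b.constr_basis ℤ z i
      change ((b.constr ℤ z (b i) : ℤ) : ℚ) = (k : ℤ) • φ (vec (b i))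
      rw [h2, hz]
      simp
    have h3 : ((b.constr ℤ z v : ℤ) : ℚ) = (k : ℤ) • φ (vec v) := LinearMap.congr_fun this v
    rw [h3]
    simp
  induction x with
  | zero => simp
  | add x y hx hy => rw [map_add, map_add, hx, hy, mul_add]
  | tmul q v =>
    have : q ⊗ₜ[ℤ] v = q • vec v := by rw [vec, TensorProduct.smul_tmul', smul_eq_mul, mul_one]
    rw [this, map_smul, map_smul, pairing_vec, h1, smul_eq_mul, smul_eq_mul]
    ring

lemma exists_isPrimitive {v : N} (hv : v ≠ 0) :
    ∃ (k : ℕ) (u : N), 0 < k ∧ IsPrimitive u ∧ v = (k : ℤ) • u := by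
  classical
  let b := Module.Free.chooseBasis ℤ N
  have hne : (Finset.univ : Finset (Module.Free.ChooseBasisIndex ℤ N)).Nonempty := by
    by_contra h
    rw [Finset.not_nonempty_iff_eq_empty, Finset.univ_eq_empty_iff] at h
    exact hv (b.ext_elem fun i => h.elim i)
  obtain ⟨g, hg, hg1⟩ := Finset.extract_gcd (b.repr v) hne
  set d := Finset.univ.gcd (b.repr v) with hd
  have hd0 : d ≠ 0 := fun h => hv (b.ext_elem fun i => by
    rw [hg i (Finset.mem_univ i), h]; simp)
  have hdn : 0 ≤ d := by
    rw [hd, ← Finset.normalize_gcd, ← Int.abs_eq_normalize]; exact abs_nonneg _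
  have huv : v = d • b.equivFun.symm g := b.ext_elem fun i => by
    rw [hg i (Finset.mem_univ i), map_smul]
    simp [Module.Basis.equivFun_symm_apply, Finsupp.single_apply]
  refine ⟨d.toNat, b.equivFun.symm g, by omega, fun k w hw => ?_, by
    rwa [Int.toNat_of_nonneg hdn]⟩
  refine isUnit_of_dvd_one ?_
  rw [← hg1]
  refine Finset.dvd_gcd fun i _ => ⟨b.repr w i, ?_⟩
  have := congrArg (fun x => b.repr x i) hw
  simpa [Module.Basis.equivFun_symm_apply, Finsupp.single_apply] using this

/-- The values at `u` of all characters form an ideal `(g)` of `ℤ`. All coordinates of `u` are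
divisible by `g`, so `g` is a unit. -/
lemma IsPrimitive.exists_dual_eq_one {u : N} (hu : IsPrimitive u) :
    ∃ χ : Module.Dual ℤ N, χ u = 1 := by
  let b := Module.Free.chooseBasis ℤ N
  let I : Ideal ℤ := LinearMap.range (Module.Dual.eval ℤ N u)
  obtain ⟨g, hg⟩ := (inferInstance : I.IsPrincipal)
  have h1 : ∀ i, ∃ c : ℤ, b.repr u i = g * c := fun i => by
    have : b.repr u i ∈ I := ⟨b.coord i, rfl⟩
    rw [hg] at this
    obtain ⟨c, hc⟩ := Submodule.mem_span_singleton.1 this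
    exact ⟨c, by rw [← hc, smul_eq_mul, mul_comm]⟩
  choose c hc using h1
  have h2 : IsUnit g := by
    refine hu g (b.equivFun.symm c) (b.ext_elem fun i => ?_)
    rw [hc i, map_smul]
    simp [Module.Basis.equivFun_symm_apply, Finsupp.single_apply]
  have h3 : (1 : ℤ) ∈ I := by
    rw [hg]
    obtain ⟨c, hc⟩ := h2.dvd (a := (1 : ℤ))
    exact Submodule.mem_span_singleton.2 ⟨c, by rw [hc, smul_eq_mul, mul_comm]⟩
  exact h3

end Lattice

end Toric

/-! ### Faces and rays of the cones of a fan -/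

namespace Fan

open Toric

variable {N : Type} [AddCommGroup N] (F : Fan N)

lemma exists_pos_functional (σ : F.cones) :
    ∃ φ : ℚ ⊗[ℤ] N →ₗ[ℚ] ℚ, ∀ x ∈ σ.1, 0 ≤ φ x ∧ (φ x = 0 → x = 0) := by
  obtain ⟨s, hs, hirr⟩ := exists_irredundant_generators (F.fg _ σ.2)
  obtain ⟨φ, hφ⟩ := exists_pos_on_generators (F.salient _ σ.2) hs
    (fun h => hirr 0 h (zero_mem _))
  refine ⟨φ, fun x hx => ?_⟩
  rw [← hs] at hx
  obtain ⟨c, hc, rfl⟩ := exists_sum_of_mem_hull hx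
  rw [map_sum]
  simp only [map_smul, smul_eq_mul]
  have hn : ∀ v ∈ s, 0 ≤ c v * φ v := fun v hv => mul_nonneg (hc v) (hφ v hv).le
  refine ⟨Finset.sum_nonneg hn, fun h => Finset.sum_eq_zero fun v hv => ?_⟩
  have := (Finset.sum_eq_zero_iff_of_nonneg hn).1 h v hv
  rw [(mul_eq_zero.1 this).resolve_right (hφ v hv).ne', zero_smul]

variable [Module.Free ℤ N] [Module.Finite ℤ N]

lemma isFace_of_linear {C τ : PointedCone ℚ (ℚ ⊗[ℤ] N)} (φ : ℚ ⊗[ℤ] N →ₗ[ℚ] ℚ)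
    (hφ : ∀ x ∈ C, 0 ≤ φ x) (hτ : ∀ x, x ∈ τ ↔ x ∈ C ∧ φ x = 0) : IsFace τ C := by
  obtain ⟨k, m, hk, hm⟩ := exists_pairing_eq_smul φ
  have hk' : (0 : ℚ) < k := by exact_mod_cast hk
  refine ⟨m, fun x hx => ?_, fun x => ?_⟩
  · rw [hm]; exact mul_nonneg hk'.le (hφ x hx)
  · rw [hτ, hm, mul_eq_zero, or_iff_right hk'.ne']

lemma bot_mem_cones : (⊥ : PointedCone ℚ (ℚ ⊗[ℤ] N)) ∈ F.cones := by
  obtain ⟨σ, hσ⟩ := F.nonempty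
  obtain ⟨φ, hφ⟩ := F.exists_pos_functional ⟨σ, hσ⟩
  refine F.face_mem σ hσ _ (isFace_of_linear φ (fun x hx => (hφ x hx).1) fun x => ?_)
  rw [Submodule.mem_bot]
  refine ⟨?_, fun h => (hφ x h.1).2 h.2⟩
  rintro rfl
  exact ⟨zero_mem _, map_zero _⟩

/-- A cone of a fan is generated by its rays. -/
lemma cone_eq_hull_rays (σ : F.cones) :
    σ.1 = PointedCone.hull ℚ (Set.range fun ρ : F.raysIn σ => vec ρ.1.1) := by
  classical
  refine le_antisymm ?_ (Submodule.span_le.2 ?_)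
  swap
  · rintro _ ⟨ρ, rfl⟩; exact ρ.2
  obtain ⟨s, hs, hirr⟩ := exists_irredundant_generators (F.fg _ σ.2)
  conv_lhs => rw [← hs]
  refine Submodule.span_le.2 fun v hv => ?_
  have hv' : v ∈ s := hv
  have hvσ : v ∈ σ.1 := hs ▸ Submodule.subset_span hv
  have hv0 : v ≠ 0 := fun h => hirr v hv' (h ▸ zero_mem _)
  obtain ⟨φ, hφ0, hφ⟩ := exists_supporting_of_irredundant (F.salient _ σ.2) hs hirr hv'
  replace hφ : ∀ w ∈ s.erase v, 0 < φ w := fun w hw =>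
    hφ w (Finset.mem_of_mem_erase hw) (Finset.ne_of_mem_erase hw)
  -- Rescale the irredundant generator `v` to a primitive lattice vector `u` on the same ray.
  obtain ⟨k, n, hk, hn⟩ := exists_vec_smul v
  have hk' : (0 : ℚ) < k := by exact_mod_cast hk
  have hn0 : n ≠ 0 := by
    rintro rfl
    have : (k : ℚ) • v = 0 := by rw [← hn]; simp [vec]
    rcases smul_eq_zero.1 this with h | h
    · exact hk'.ne' h
    · exact hv0 h
  obtain ⟨l, u, hl, hu, hnu⟩ := exists_isPrimitive hn0
  have hl' : (0 : ℚ) < l := by exact_mod_cast hl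
  rw [hnu, vec_zsmul, Int.cast_natCast] at hn
  have hvu : v = ((k : ℚ)⁻¹ * l) • vec u := by
    rw [← smul_smul, hn, smul_smul, inv_mul_cancel₀ hk'.ne', one_smul]
  have huv : vec u = ((l : ℚ)⁻¹ * k) • v := by
    rw [← smul_smul, ← hn, smul_smul, inv_mul_cancel₀ hl'.ne', one_smul]
  have hpos : 0 ≤ (k : ℚ)⁻¹ * l := mul_nonneg (inv_nonneg.2 hk'.le) hl'.le
  have huσ : vec u ∈ σ.1 := by
    rw [huv]; exact smul_mem_cone (mul_nonneg (inv_nonneg.2 hl'.le) hk'.le) hvσ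
  have hφu : φ (vec u) = 0 := by rw [huv, map_smul, hφ0, smul_zero]
  -- The supporting functional is nonnegative on `σ` and vanishes there only on the ray of `v`, so
  -- this ray is a face and belongs to the fan.
  have hray : rayCone u ∈ F.cones := by
    refine F.face_mem σ.1 σ.2 _ (isFace_of_linear φ (fun x hx => ?_) fun x => ⟨fun hx => ?_, ?_⟩)
    · rw [← hs] at hx
      obtain ⟨c, hc, rfl⟩ := exists_sum_of_mem_hull hx
      rw [← Finset.add_sum_erase _ _ hv', map_add, map_smul, hφ0, smul_zero, zero_add, map_sum]
      refine Finset.sum_nonneg fun w hw => ?_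
      rw [map_smul]
      exact mul_nonneg (hc w) (hφ w hw).le
    · obtain ⟨q, hq, rfl⟩ := mem_rayCone.1 hx
      exact ⟨smul_mem_cone hq huσ, by rw [map_smul, hφu, smul_zero]⟩
    · rintro ⟨hx, hx0⟩
      rw [← hs] at hx
      obtain ⟨c, hc, rfl⟩ := exists_sum_of_mem_hull hx
      rw [← Finset.add_sum_erase _ _ hv'] at hx0 ⊢
      rw [map_add, map_smul, hφ0, smul_zero, zero_add, map_sum] at hx0
      simp only [map_smul, smul_eq_mul] at hx0
      have h1 := (Finset.sum_eq_zero_iff_of_nonneg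
        (fun w hw => mul_nonneg (hc w) (hφ w hw).le)).1 hx0
      have h2 : ∑ w ∈ s.erase v, c w • w = 0 := Finset.sum_eq_zero fun w hw => by
        rw [(mul_eq_zero.1 (h1 w hw)).resolve_right (hφ w hw).ne', zero_smul]
      rw [h2, add_zero]
      exact mem_rayCone.2 ⟨_, mul_nonneg (hc v) hpos, by rw [mul_smul, ← hvu]⟩
  let ρ : F.raysIn σ := ⟨⟨u, hu, hray⟩, huσ⟩
  have hρ : vec u ∈ PointedCone.hull ℚ (Set.range fun ρ : F.raysIn σ => vec ρ.1.1) :=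
    Submodule.subset_span (Set.mem_range_self ρ)
  exact hvu ▸ smul_mem_cone hpos hρ

lemma mem_dualMonoid_iff (σ : F.cones) (χ : Module.Dual ℤ N) :
    χ ∈ dualMonoid σ.1 ↔ ∀ ρ : F.raysIn σ, 0 ≤ χ ρ.1.1 := by
  refine ⟨fun h ρ => ?_, fun h x hx => ?_⟩
  · have := h _ ρ.2
    rw [pairing_vec] at this
    exact_mod_cast this
  · rw [F.cone_eq_hull_rays σ] at hx
    induction hx using Submodule.span_induction with
    | mem x hx =>
      obtain ⟨ρ, rfl⟩ := hx
      simpa using h ρ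
    | zero => simp
    | add x y _ _ hx hy => rw [map_add]; exact add_nonneg hx hy
    | smul a x _ hx =>
      have : pairing χ (a • x) = (a : ℚ) * pairing χ x := by
        rw [← smul_eq_mul, ← map_smul]; rfl
      rw [this]
      exact mul_nonneg a.2 hx

end Fan

/-! ### Ideals spanned by monomials in monoid algebras -/

lemma Ideal.eq_of_le_of_height_eq_one {R : Type} [CommRing R] [IsDomain R] {P Q : Ideal R}
    [P.IsPrime] [Q.IsPrime] (hP : P ≠ ⊥) (h : P ≤ Q) (hQ : Q.height = 1) : P = Q := by
  by_contra hne
  have h1 : P.height < 1 :=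
    (Ideal.height_le_iff (p := Q) (n := 1)).1 hQ.le P inferInstance (lt_of_le_of_ne h hne)
  exact hP (Ideal.height_eq_zero_iff_eq_bot.1 (Order.lt_one_iff.1 h1))

lemma Ideal.height_pos_of_ne_bot {R : Type} [CommRing R] [IsDomain R] {P : Ideal R} [P.IsPrime]
    (hP : P ≠ ⊥) : 1 ≤ P.height := by
  exact Order.one_le_iff_ne_zero.2 fun h => hP (Ideal.height_eq_zero_iff_eq_bot.1 h)

namespace AddMonoidAlgebra

variable {A : Type} [AddCommMonoid A]

lemma exists_add_of_coeff_mul_ne_zero {f g : ℂ[A]} {c : A} (h : (f * g).coeff c ≠ 0) :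
    ∃ a b, f.coeff a ≠ 0 ∧ g.coeff b ≠ 0 ∧ a + b = c := by
  classical
  rw [AddMonoidAlgebra.coeff_mul] at h
  obtain ⟨a, ha, h⟩ := Finset.exists_ne_zero_of_sum_ne_zero h
  obtain ⟨b, hb, h⟩ := Finset.exists_ne_zero_of_sum_ne_zero h
  refine ⟨a, b, Finsupp.mem_support_iff.1 ha, Finsupp.mem_support_iff.1 hb, ?_⟩
  by_contra hc
  exact h (if_neg hc)

/-- Among the monomials of `f` and `g` with least `φ`-value, there are two whose product occurs in
`f * g`. -/
lemma exists_min_coeff_mul_ne_zero [UniqueSums A] (φ : A →+ ℤ) {f g : ℂ[A]} (hf : f ≠ 0)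
    (hg : g ≠ 0) :
    ∃ a b, f.coeff a ≠ 0 ∧ (∀ a', f.coeff a' ≠ 0 → φ a ≤ φ a') ∧ g.coeff b ≠ 0 ∧
      (∀ b', g.coeff b' ≠ 0 → φ b ≤ φ b') ∧ (f * g).coeff (a + b) ≠ 0 := by
  classical
  have key : ∀ f : ℂ[A], f ≠ 0 → ∃ a ∈ f.coeff.support, ∀ a' ∈ f.coeff.support, φ a ≤ φ a' :=
    fun f hf => Finset.exists_min_image _ _ (by
      rw [Finsupp.support_nonempty_iff]
      exact fun h => hf (AddMonoidAlgebra.coeff_injective h))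
  obtain ⟨a₁, ha₁, ha₁'⟩ := key f hf
  obtain ⟨b₁, hb₁, hb₁'⟩ := key g hg
  -- Unique sums are applied to the exponents of least `φ`-value only. Any other pair of exponents
  -- with the same sum must have least values too, so the sum is unique among all exponents.
  obtain ⟨a, ha, b, hb, hab⟩ := UniqueSums.uniqueAdd_of_nonempty
    (A := f.coeff.support.filter fun a => φ a = φ a₁)
    (B := g.coeff.support.filter fun b => φ b = φ b₁)
    ⟨a₁, by simpa using ha₁⟩ ⟨b₁, by simpa using hb₁⟩
  rw [Finset.mem_filter] at ha hb
  have hu : UniqueAdd f.coeff.support g.coeff.support a b := by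
    intro a' b' ha' hb' h
    have h1 := ha₁' a' ha'
    have h2 := hb₁' b' hb'
    have h3 := congrArg φ h
    rw [map_add, map_add, ha.2, hb.2] at h3
    exact hab (Finset.mem_filter.2 ⟨ha', by omega⟩) (Finset.mem_filter.2 ⟨hb', by omega⟩) h
  have ha0 := Finsupp.mem_support_iff.1 ha.1
  have hb0 := Finsupp.mem_support_iff.1 hb.1
  refine ⟨a, b, ha0, fun a' h => ?_, hb0, fun b' h => ?_, ?_⟩
  · rw [ha.2]; exact ha₁' a' (Finsupp.mem_support_iff.2 h)
  · rw [hb.2]; exact hb₁' b' (Finsupp.mem_support_iff.2 h)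
  · rw [AddMonoidAlgebra.coeff_mul_add_of_uniqueAdd hu]
    exact mul_ne_zero ha0 hb0

instance isDomain_of_uniqueSums [UniqueSums A] : IsDomain ℂ[A] := NoZeroDivisors.to_isDomain _

/-- The ideal spanned by the monomials with positive `φ`-value. -/
def monomialIdeal (φ : A →+ ℤ) (hφ : ∀ a, 0 ≤ φ a) : Ideal ℂ[A] where
  carrier := {f | ∀ a, φ a = 0 → f.coeff a = 0}
  zero_mem' a _ := rfl
  add_mem' hf hg a ha := by
    rw [AddMonoidAlgebra.coeff_add, Finsupp.add_apply, hf a ha, hg a ha, add_zero]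
  smul_mem' f g hg c hc := by
    by_contra h
    obtain ⟨a, b, -, hb, rfl⟩ := exists_add_of_coeff_mul_ne_zero h
    have h1 := hφ a
    have h2 := hφ b
    rw [map_add] at hc
    exact hb (hg b (by omega))

variable {φ : A →+ ℤ} {hφ : ∀ a, 0 ≤ φ a}

lemma mem_monomialIdeal {f : ℂ[A]} :
    f ∈ monomialIdeal φ hφ ↔ ∀ a, φ a = 0 → f.coeff a = 0 := Iff.rfl

lemma single_mem_monomialIdeal {a : A} {c : ℂ} (hc : c ≠ 0) :
    single a c ∈ monomialIdeal φ hφ ↔ φ a ≠ 0 := by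
  classical
  rw [mem_monomialIdeal]
  refine ⟨fun h h0 => hc (by simpa using h a h0), fun h b hb => ?_⟩
  rw [AddMonoidAlgebra.coeff_single, Finsupp.single_apply, if_neg]
  rintro rfl
  exact h hb

/-- If `f` and `g` both have an exponent of value zero, then zero is their least value, and some
product of lowest terms survives in `f * g` with value zero. -/
lemma isPrime_monomialIdeal [UniqueSums A] : (monomialIdeal φ hφ).IsPrime := by
  refine ⟨fun h => ?_, fun {f g} h => ?_⟩
  · have : (1 : ℂ[A]) ∈ monomialIdeal φ hφ := h ▸ Submodule.mem_top
    rw [AddMonoidAlgebra.one_def, single_mem_monomialIdeal one_ne_zero] at this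
    exact this (map_zero φ)
  · by_contra! hn
    simp only [mem_monomialIdeal, not_forall] at hn
    obtain ⟨⟨a₀, ha₀, hf⟩, ⟨b₀, hb₀, hg⟩⟩ := hn
    obtain ⟨a, b, -, ha, -, hb, hab⟩ := exists_min_coeff_mul_ne_zero φ (f := f) (g := g)
      (by rintro rfl; exact hf rfl) (by rintro rfl; exact hg rfl)
    have h1 := ha _ hf
    have h2 := hb _ hg
    have h3 := hφ a
    have h4 := hφ b
    exact hab (h _ (by rw [map_add]; omega))

/-- An injective map of exponents merges no monomials, so only the loci `φ = 0` matter. This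
computes the images of generic points under the face inclusions and under the log Cox construction.
-/
lemma comap_monomialIdeal {A' : Type} [AddCommMonoid A'] {φ' : A' →+ ℤ} {hφ' : ∀ a, 0 ≤ φ' a}
    {g : A →+ A'} (hg : Function.Injective g) (h : ∀ a, φ a = 0 ↔ φ' (g a) = 0) :
    (monomialIdeal φ' hφ').comap (mapDomainRingHom ℂ g) = monomialIdeal φ hφ := by
  ext f
  have hc : ∀ a, ((mapDomainRingHom ℂ g) f).coeff (g a) = f.coeff a := fun a =>
    Finsupp.mapDomain_apply hg f.coeff a
  rw [Ideal.mem_comap, mem_monomialIdeal, mem_monomialIdeal]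
  refine ⟨fun hf a ha => ?_, fun hf a ha => ?_⟩
  · rw [← hc, hf _ ((h a).1 ha)]
  · by_cases hr : a ∈ Set.range g
    · obtain ⟨a, rfl⟩ := hr
      rw [hc, hf a ((h a).2 ha)]
    · exact Finsupp.mapDomain_of_notMem_range _ _ hr

/-- If the elements of positive `φ`-value are the translates `x + b`, then the ideal of the
monomials with positive `φ`-value is generated by `x`. -/
lemma monomialIdeal_eq_span {x : A} (hx : φ x ≠ 0) (hdiv : ∀ a, φ a ≠ 0 → ∃ b, a = x + b) :
    monomialIdeal φ hφ = Ideal.span {single x 1} := by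
  refine le_antisymm (fun f hf => ?_) ?_
  · rw [← AddMonoidAlgebra.sum_coeff_single f]
    refine Ideal.sum_mem _ fun a ha => ?_
    obtain ⟨b, hb⟩ := hdiv a fun h => Finsupp.mem_support_iff.1 ha (hf a h)
    refine Ideal.mem_span_singleton.2 ⟨single b (f.coeff a), ?_⟩
    rw [AddMonoidAlgebra.single_mul_single, one_mul, ← hb]
  · rw [Ideal.span_le, Set.singleton_subset_iff]
    exact (single_mem_monomialIdeal one_ne_zero).2 hx

lemma monomialIdeal_ne_bot {x : A} (hx : φ x ≠ 0) : monomialIdeal φ hφ ≠ ⊥ := fun h => by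
  have : single x 1 ∈ monomialIdeal φ hφ := (single_mem_monomialIdeal one_ne_zero).2 hx
  rw [h, Ideal.mem_bot, AddMonoidAlgebra.single_eq_zero] at this
  exact one_ne_zero this

/-- The algebra is not assumed Noetherian, so Krull's theorem is replaced by a direct argument. A
prime `Q` strictly inside `(x)` does not contain `x`, so its elements can be divided by `x` within
`Q` forever, and their exponents would have arbitrarily large `φ`-value. -/
lemma height_monomialIdeal [UniqueSums A] {x : A} (hx : φ x ≠ 0)
    (hdiv : ∀ a, φ a ≠ 0 → ∃ b, a = x + b) : (monomialIdeal φ hφ).height = 1 := by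
  have := isPrime_monomialIdeal (φ := φ) (hφ := hφ)
  refine le_antisymm ?_ (Ideal.height_pos_of_ne_bot (monomialIdeal_ne_bot hx))
  refine (Ideal.height_le_iff (n := 1)).2 fun Q hQ hlt => ?_
  suffices Q = ⊥ by
    subst this
    rw [Ideal.height_bot]
    exact one_pos
  have hspan := monomialIdeal_eq_span (hφ := hφ) hx hdiv
  have hxQ : single x (1 : ℂ) ∉ Q := fun h => by
    refine hlt.not_ge ?_
    rw [hspan, Ideal.span_le, Set.singleton_subset_iff]
    exact h
  have key : ∀ n : ℕ, ∀ f ∈ Q, ∀ a, f.coeff a ≠ 0 → n ≤ φ a := by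
    intro n
    induction n with
    | zero => intro f _ a _; simpa using hφ a
    | succ n ih =>
      intro f hf a ha
      have h1 := hlt.le hf
      rw [hspan] at h1
      obtain ⟨g, rfl⟩ := Ideal.mem_span_singleton.1 h1
      have hg := (hQ.mem_or_mem hf).resolve_left hxQ
      obtain ⟨b, c, hb, hc, rfl⟩ := exists_add_of_coeff_mul_ne_zero ha
      have h2 := ih g hg c hc
      have h3 : b = x := by
        by_contra hbx
        exact hb (by classical rw [AddMonoidAlgebra.coeff_single, Finsupp.single_apply,
          if_neg (Ne.symm hbx)])
      have h4 := hφ x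
      rw [h3, map_add]
      push_cast
      omega
  rw [eq_bot_iff]
  intro f hf
  rw [Ideal.mem_bot]
  by_contra h0
  obtain ⟨a, ha⟩ : ∃ a, f.coeff a ≠ 0 := by
    by_contra! h
    exact h0 (AddMonoidAlgebra.coeff_injective (Finsupp.ext h))
  have := key ((φ a).toNat + 1) f hf a ha
  have := hφ a
  omega

end AddMonoidAlgebra

/-! ### Orbit ideals and the generic points of the divisors `D_ρ` -/

namespace Toric

variable {N : Type} [AddCommGroup N] [Module.Free ℤ N] [Module.Finite ℤ N]

instance (S : AddSubmonoid (Module.Dual ℤ N)) : UniqueSums S := by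
  let b := Module.Free.chooseBasis ℤ N
  let g : S →+ (Module.Free.ChooseBasisIndex ℤ N → ℤ) :=
    { toFun := fun χ i => χ.1 (b i)
      map_zero' := rfl
      map_add' := fun _ _ => rfl }
  refine UniqueSums.of_injective_addHom g.toAddHom (fun χ χ' h => Subtype.ext ?_) inferInstance
  exact b.ext fun i => congrFun h i

end Toric

namespace Toric

open AddMonoidAlgebra

variable {N : Type} [AddCommGroup N]

/-- The pairing of the characters in `S_σ` with a lattice vector. -/
def evalAt (σ : PointedCone ℚ (ℚ ⊗[ℤ] N)) (u : N) : dualMonoid σ →+ ℤ where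
  toFun χ := χ.1 u
  map_zero' := rfl
  map_add' _ _ := rfl

@[simp] lemma evalAt_apply {σ : PointedCone ℚ (ℚ ⊗[ℤ] N)} (u : N) (χ : dualMonoid σ) :
    evalAt σ u χ = χ.1 u := rfl

lemma evalAt_nonneg {σ : PointedCone ℚ (ℚ ⊗[ℤ] N)} {u : N} (hu : vec u ∈ σ) (χ : dualMonoid σ) :
    0 ≤ evalAt σ u χ := by
  have := χ.2 _ hu
  rw [pairing_vec] at this
  exact_mod_cast this

lemma vec_mem_rayCone (u : N) : vec u ∈ rayCone u := mem_rayCone.2 ⟨1, by simp, by simp⟩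

lemma rayCone_le {σ : PointedCone ℚ (ℚ ⊗[ℤ] N)} {u : N} (hu : vec u ∈ σ) : rayCone u ≤ σ := by
  intro x hx
  obtain ⟨q, hq, rfl⟩ := mem_rayCone.1 hx
  exact smul_mem_cone hq hu

lemma mem_dualMonoid_rayCone {u : N} {χ : Module.Dual ℤ N} :
    χ ∈ dualMonoid (rayCone u) ↔ 0 ≤ χ u := by
  refine ⟨fun h => evalAt_nonneg (vec_mem_rayCone u) ⟨χ, h⟩, fun h x hx => ?_⟩
  obtain ⟨q, hq, rfl⟩ := mem_rayCone.1 hx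
  rw [map_smul, pairing_vec, smul_eq_mul]
  exact mul_nonneg hq (by exact_mod_cast h)

/-- The ideal of `ℂ[S_σ]` spanned by the characters that are positive on `u ∈ σ`. -/
abbrev orbitIdeal (σ : PointedCone ℚ (ℚ ⊗[ℤ] N)) (u : N) (hu : vec u ∈ σ) : Ideal ℂ[dualMonoid σ] :=
  monomialIdeal (evalAt σ u) (evalAt_nonneg hu)

/-- `orbitHom` keeps the coefficients at exponents orthogonal to `u` and drops the others, so its
kernel can be read off coefficientwise. -/
lemma ker_orbitHom (u : N) :
    (⊥ : Ideal ℂ[Module.Dual ℤ N]).comap (orbitHom u).toRingHom =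
      orbitIdeal (rayCone u) u (vec_mem_rayCone u) := by
  classical
  have hs : ∀ (a : dualMonoid (rayCone u)) (c : ℂ), orbitHom u (single a c) =
      if a.1 u = 0 then single a.1 c else 0 := by
    intro a c
    rw [orbitHom, AddMonoidAlgebra.lift_single]
    by_cases h : a.1 u = 0
    · simp [h]
    · simp [h]
  have h1 : ∀ f (χ : dualMonoid (rayCone u)), χ.1 u = 0 →
      (orbitHom u f).coeff χ.1 = f.coeff χ := by
    intro f χ hχ
    induction f using AddMonoidAlgebra.induction_linear with
    | zero => simp
    | add f g hf hg => rw [map_add, coeff_add, coeff_add, Finsupp.add_apply, hf, hg]; rfl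
    | single a c =>
      rw [hs]
      by_cases h : a.1 u = 0
      · rw [if_pos h, coeff_single, coeff_single, Finsupp.single_apply, Finsupp.single_apply]
        simp only [Subtype.ext_iff]
      · rw [if_neg h, coeff_single, Finsupp.single_apply, if_neg]
        · simp
        · rintro rfl; exact h hχ
  have h2 : ∀ f (χ : Module.Dual ℤ N), χ u ≠ 0 → (orbitHom u f).coeff χ = 0 := by
    intro f χ hχ
    induction f using AddMonoidAlgebra.induction_linear with
    | zero => simp
    | add f g hf hg => rw [map_add, coeff_add, Finsupp.add_apply, hf, hg, add_zero]
    | single a c =>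
      rw [hs]
      by_cases h : a.1 u = 0
      · rw [if_pos h, coeff_single, Finsupp.single_apply, if_neg]
        rintro rfl; exact hχ h
      · rw [if_neg h]; simp
  ext f
  rw [Ideal.mem_comap, Ideal.mem_bot, mem_monomialIdeal]
  refine ⟨fun h χ hχ => ?_, fun h => coeff_injective (Finsupp.ext fun χ => ?_)⟩
  · rw [← h1 f χ hχ]
    exact congrArg (fun f => f.coeff χ.1) h
  · by_cases hχ : χ u = 0
    · exact (h1 f ⟨χ, mem_dualMonoid_rayCone.2 hχ.ge⟩ hχ).trans (h _ hχ)
    · exact h2 f χ hχ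

variable [Module.Free ℤ N] [Module.Finite ℤ N]

/-- The generic point of the orbit closure in `U_σ` that belongs to the face of `σ` with `u` in its
relative interior. -/
def orbitPoint (σ : PointedCone ℚ (ℚ ⊗[ℤ] N)) (u : N) (hu : vec u ∈ σ) :
    affineChart σ := ⟨orbitIdeal σ u hu, isPrime_monomialIdeal⟩

/-- `S_ρ` is the half space `χ u ≥ 0`, so a character with value one at the primitive `u` divides
every character with positive value. -/
lemma height_orbitIdeal_rayCone {u : N} (hu : IsPrimitive u) :
    (orbitIdeal (rayCone u) u (vec_mem_rayCone u)).height = 1 := by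
  obtain ⟨χ, hχ⟩ := hu.exists_dual_eq_one
  refine height_monomialIdeal (x := ⟨χ, mem_dualMonoid_rayCone.2 (by omega)⟩)
    (by rw [evalAt_apply, hχ]; exact one_ne_zero) fun a ha => ?_
  have := evalAt_nonneg (vec_mem_rayCone u) a
  rw [evalAt_apply] at this ha
  refine ⟨⟨a.1 - χ, mem_dualMonoid_rayCone.2 ?_⟩, Subtype.ext (by simp)⟩
  rw [LinearMap.sub_apply]
  omega

end Toric

namespace Fan

open Toric AddMonoidAlgebra

variable {N : Type} [AddCommGroup N] (F : Fan N)

lemma chart_affineMap {τ σ : F.cones} (h : τ.1 ≤ σ.1) (x : affineChart τ.1) :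
    F.chart σ (affineMap h x) = F.chart τ x :=
  congrArg (fun f => f x) (Limits.colimit.w F.diagram (homOfLE h : τ ⟶ σ))

lemma exists_chart_eq (x : F.toricVariety) : ∃ σ y, F.chart σ y = x :=
  Scheme.IsLocallyDirected.ι_jointly_surjective F.diagram x

lemma exists_of_chart_eq_chart {σ τ : F.cones} {x : affineChart σ.1} {y : affineChart τ.1}
    (h : F.chart σ x = F.chart τ y) :
    ∃ (k : F.cones) (hσ : k.1 ≤ σ.1) (hτ : k.1 ≤ τ.1) (z : affineChart k.1),
      affineMap hσ z = x ∧ affineMap hτ z = y := by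
  obtain ⟨k, fi, fj, z, hz, hz'⟩ :=
    (Scheme.IsLocallyDirected.ι_eq_ι_iff F.diagram (xi := x) (xj := y)).1 h
  exact ⟨k, leOfHom fi, leOfHom fj, z, hz, hz'⟩

lemma coheight_chart (σ : F.cones) (y : affineChart σ.1) :
    Order.coheight (F.chart σ y) = y.asIdeal.height := by
  rw [idealHeight_eq_coheight]
  exact coheight_eq_of_isOpenImmersion (F.chart σ)

variable [Module.Free ℤ N] [Module.Finite ℤ N]

lemma divisor_eq_rayOf (ρ : F.rays) :
    F.divisor ρ = F.chart (F.rayOf ρ) (orbitPoint (F.rayOf ρ).1 ρ.1 (vec_mem_rayCone ρ.1)) :=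
  congrArg (F.chart (F.rayOf ρ)) (PrimeSpectrum.ext (ker_orbitHom ρ.1))

lemma divisor_eq (σ : F.cones) (ρ : F.rays) (hρ : ρ ∈ F.raysIn σ) :
    F.divisor ρ = F.chart σ (orbitPoint σ.1 ρ.1 hρ) := by
  have hle : (F.rayOf ρ).1 ≤ σ.1 := rayCone_le hρ
  rw [divisor_eq_rayOf, ← F.chart_affineMap hle]
  refine congrArg (F.chart σ) (PrimeSpectrum.ext ?_)
  exact comap_monomialIdeal (hφ := evalAt_nonneg hρ)
    (hφ' := evalAt_nonneg (σ := (F.rayOf ρ).1) (vec_mem_rayCone ρ.1))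
    (AddSubmonoid.inclusion_injective (dualMonoid_anti hle)) fun a => Iff.rfl

/-- The generic point of `D_ρ` lies in `U_k` for a common face `k` of `ρ` and `σ`, cut out of `ρ` by
a character `m`. If `m` vanishes at `u_ρ`, then `k` contains `u_ρ`. Otherwise `χ^m` would vanish at
a point of `U_k`, where it is invertible. -/
lemma mem_raysIn_of_divisor_eq {σ : F.cones} {ρ : F.rays} {y : affineChart σ.1}
    (h : F.divisor ρ = F.chart σ y) : ρ ∈ F.raysIn σ := by
  rw [divisor_eq_rayOf] at h
  obtain ⟨k, hk, hk', z, hz, -⟩ := F.exists_of_chart_eq_chart h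
  obtain ⟨m, hm, hmk⟩ := F.isFace_of_le hk
  by_cases hm0 : m ρ.1 = 0
  · refine hk' ((hmk _).2 ⟨vec_mem_rayCone ρ.1, ?_⟩)
    rw [pairing_vec, hm0, Int.cast_zero]
  · exfalso
    have h1 : single (⟨m, hm⟩ : dualMonoid (F.rayOf ρ).1) (1 : ℂ) ∈
        orbitIdeal (F.rayOf ρ).1 ρ.1 (vec_mem_rayCone ρ.1) :=
      (single_mem_monomialIdeal one_ne_zero).2 hm0
    have h2 : inclHom (dualMonoid_anti hk) (single (⟨m, hm⟩ : dualMonoid (F.rayOf ρ).1) (1 : ℂ)) ∈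
        z.asIdeal := by
      have h4 : (affineMap hk z).asIdeal = orbitIdeal (F.rayOf ρ).1 ρ.1 (vec_mem_rayCone ρ.1) :=
        congrArg PrimeSpectrum.asIdeal hz
      rw [← h4] at h1
      exact h1
    have h3 : -m ∈ dualMonoid k.1 := fun x hx => by
      rw [pairing_neg, ((hmk x).1 hx).2, neg_zero]
    refine z.2.ne_top (Ideal.eq_top_of_isUnit_mem _ h2 ?_)
    refine IsUnit.of_mul_eq_one (single ⟨-m, h3⟩ (1 : ℂ)) ?_
    rw [inclHom, mapDomainRingHom_apply, mapDomain_single, single_mul_single,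
      AddMonoidAlgebra.one_def, one_mul]
    congr 1
    exact Subtype.ext (add_neg_cancel m)

/-- This keeps the coefficients of `Δ` at different rays from being added up at one point. -/
lemma divisor_injective : Function.Injective F.divisor := by
  intro ρ ρ' h
  have h1 : ρ ∈ F.raysIn (F.rayOf ρ') :=
    F.mem_raysIn_of_divisor_eq (h.trans (F.divisor_eq_rayOf ρ'))
  have h2 : ρ' ∈ F.raysIn (F.rayOf ρ) :=
    F.mem_raysIn_of_divisor_eq (h.symm.trans (F.divisor_eq_rayOf ρ))
  exact Subtype.ext (eq_of_rayCone_eq ρ.2.1 ρ'.2.1 (le_antisymm (rayCone_le h1) (rayCone_le h2)))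

lemma coheight_divisor (ρ : F.rays) : Order.coheight (F.divisor ρ) = 1 := by
  rw [divisor_eq_rayOf, coheight_chart]
  exact height_orbitIdeal_rayCone ρ.2.1

lemma boundary_divisor (m : F.rays → ℕ) (ρ : F.rays) :
    F.boundary m (F.divisor ρ) = 1 - 1 / (m ρ : ℚ) := by
  classical
  rw [boundary, Finsupp.finsetSum_apply, Finset.sum_eq_single ρ]
  · simp
  · intro ρ' _ h
    rw [Finsupp.single_apply, if_neg fun h' => h (F.divisor_injective h')]
  · simp

lemma boundary_eq_zero (m : F.rays → ℕ) {x : F.toricVariety} (hx : ∀ ρ, x ≠ F.divisor ρ) :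
    F.boundary m x = 0 := by
  classical
  rw [boundary, Finsupp.finsetSum_apply]
  refine Finset.sum_eq_zero fun ρ _ => ?_
  rw [Finsupp.single_apply, if_neg (hx ρ).symm]

end Fan

/-! ### From `ℚ`-factorial to simplicial -/

/-- Near a point of an affine open subscheme `Spec A`, a function on `X` vanishes where the
numerator of a fraction of elements of `A` does. -/
lemma AlgebraicGeometry.Scheme.exists_isUnit_germ_iff {X : Scheme.{0}} {A : Type} [CommRing A]
    (j : Spec (CommRingCat.of A) ⟶ X) (q : Spec (CommRingCat.of A)) (W : X.Opens) (hq : j q ∈ W)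
    (f : Γ(X, W)) :
    ∃ a b : A, b ∉ q.asIdeal ∧ ∀ y : Spec (CommRingCat.of A), b ∉ y.asIdeal →
      ∃ hy : j y ∈ W, (IsUnit (X.presheaf.germ W (j y) hy f) ↔ a ∉ y.asIdeal) := by
  let Y : Scheme.{0} := Spec (CommRingCat.of A)
  let g : Γ(Y, j ⁻¹ᵁ W) := j.app W f
  obtain ⟨_, ⟨_, ⟨b, rfl⟩, rfl⟩, hqb, hbW⟩ :=
    PrimeSpectrum.isBasis_basic_opens.exists_subset_of_mem_open
    (show q ∈ (j ⁻¹ᵁ W : Set Y) from hq) (j ⁻¹ᵁ W).isOpen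
  let s : Γ(Y, ⊤) := (Scheme.ΓSpecIso (CommRingCat.of A)).inv b
  have hs : Y.basicOpen s = PrimeSpectrum.basicOpen b :=
    AlgebraicGeometry.basicOpen_eq_of_affine (R := CommRingCat.of A) _
  have hle : Y.basicOpen s ≤ j ⁻¹ᵁ W := by rw [hs]; exact hbW
  have hloc := (isAffineOpen_top Y).isLocalization_basicOpen s
  -- On the basic open set of `b` the function is a fraction `a' / b ^ n`, hence invertible exactly
  -- where `a'` is.
  obtain ⟨n, a', ha'⟩ := IsLocalization.Away.surj s (Y.presheaf.map (homOfLE hle).op g)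
  let a : A := (Scheme.ΓSpecIso (CommRingCat.of A)).hom a'
  have haa : a' = (Scheme.ΓSpecIso (CommRingCat.of A)).inv a := by simp [a]
  have ha : Y.basicOpen a' = PrimeSpectrum.basicOpen a := by
    rw [haa]; exact AlgebraicGeometry.basicOpen_eq_of_affine (R := CommRingCat.of A) _
  refine ⟨a, b, hqb, fun y hy => ?_⟩
  have hyW : j y ∈ W := hbW hy
  refine ⟨hyW, ?_⟩
  have hy' : y ∈ Y.basicOpen s := by rw [hs]; exact hy
  have h1 : Y.basicOpen s ⊓ Y.basicOpen g = Y.basicOpen s ⊓ Y.basicOpen a' := by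
    have hu : IsUnit (algebraMap Γ(Y, ⊤) Γ(Y, Y.basicOpen s) s ^ n) :=
      (IsLocalization.Away.algebraMap_isUnit s).pow n
    have h2 := congrArg Y.basicOpen ha'
    rw [Scheme.basicOpen_mul, Scheme.basicOpen_of_isUnit _ hu, Scheme.basicOpen_res] at h2
    have h3 : Y.basicOpen (algebraMap Γ(Y, ⊤) Γ(Y, Y.basicOpen s) a') =
        Y.basicOpen s ⊓ Y.basicOpen a' := Scheme.basicOpen_res _ _ _
    rw [← h3, ← h2, inf_right_comm, inf_idem]
  refine (Scheme.mem_basicOpen X f (j y) hyW).symm.trans ?_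
  change y ∈ j ⁻¹ᵁ X.basicOpen f ↔ _
  rw [Scheme.preimage_basicOpen]
  have h4 : y ∈ Y.basicOpen s ⊓ Y.basicOpen g ↔ y ∈ Y.basicOpen s ⊓ Y.basicOpen a' := by rw [h1]
  have h5 : y ∈ Y.basicOpen g ↔ y ∈ Y.basicOpen a' :=
    ⟨fun h => (h4.1 ⟨hy', h⟩).2, fun h => (h4.2 ⟨hy', h⟩).2⟩
  rw [ha] at h5
  exact h5

lemma IsLocalRing.not_isUnit_of_span_eq_pow {R : Type} [CommRing R] [IsLocalRing R] {f : R} {n : ℕ}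
    (hn : 0 < n) (h : Ideal.span {f} = IsLocalRing.maximalIdeal R ^ n) : ¬ IsUnit f := by
  intro hf
  rw [Ideal.span_singleton_eq_top.2 hf] at h
  have := h.trans_le (Ideal.pow_le_self hn.ne')
  exact (IsLocalRing.maximalIdeal.isMaximal R).ne_top (top_le_iff.1 this)

/-- If no prime ideal of height one over `a` is disjoint from the multiplicative set `S`, then a
multiple of `a` lies in `S`. -/
lemma exists_mul_mem_of_forall_height_one {R : Type} [CommRing R] [IsDomain R] [IsNoetherianRing R]
    {a : R} (ha : a ≠ 0) (S : Submonoid R)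
    (h : ∀ Q : Ideal R, Q.IsPrime → Q.height = 1 → Disjoint (Q : Set R) S → a ∉ Q) :
    ∃ b, a * b ∈ S := by
  by_contra! hS
  have hd : Disjoint ((Ideal.span {a} : Ideal R) : Set R) S := by
    rw [Set.disjoint_left]
    intro x hx
    obtain ⟨b, rfl⟩ := Ideal.mem_span_singleton.1 hx
    exact hS b
  obtain ⟨Q, hQ, haQ, hQS⟩ := Ideal.exists_le_prime_disjoint _ S hd
  -- A minimal prime over `(a)` inside `Q` has height one by Krull's theorem and is still disjoint
  -- from `S`.
  obtain ⟨P, hP, hPQ⟩ := Ideal.exists_minimalPrimes_le haQ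
  have hPp := hP.isPrime
  have haP : a ∈ P := hP.le (Ideal.mem_span_singleton_self a)
  refine h P hPp (le_antisymm ?_ (Ideal.height_pos_of_ne_bot ?_))
    (hQS.mono_left hPQ) haP
  · exact Ideal.height_le_one_of_isPrincipal_of_mem_minimalPrimes _ P hP
  · rintro rfl
    exact ha haP

namespace Fan

open Toric AddMonoidAlgebra

variable {N : Type} [AddCommGroup N] [Module.Free ℤ N] (F : Fan N)

/-- This is the ring of the torus, since the dual of the zero cone is all of `M`. Krull's theorem is
applied only there, so finite generation of the other semigroups `S_σ` is not needed. -/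
instance [Module.Finite ℤ N] : IsNoetherianRing ℂ[dualMonoid (⊥ : PointedCone ℚ (ℚ ⊗[ℤ] N))] := by
  have htop : dualMonoid (⊥ : PointedCone ℚ (ℚ ⊗[ℤ] N)) = ⊤ := by
    refine eq_top_iff.2 fun χ _ x hx => ?_
    rw [(Submodule.mem_bot _).1 hx, map_zero]
  have hM : AddMonoid.FG (Module.Dual ℤ N) := by
    rw [← AddGroup.fg_iff_addMonoid_fg, ← Module.Finite.iff_addGroup_fg]
    infer_instance
  have : AddMonoid.FG (dualMonoid (⊥ : PointedCone ℚ (ℚ ⊗[ℤ] N))) := by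
    rw [AddMonoid.fg_iff_addSubmonoid_fg, htop]
    exact hM.1
  exact Algebra.FiniteType.isNoetherianRing ℂ _

instance (σ : F.cones) : Fintype (F.raysIn σ) := Fintype.ofFinite _

/-- The sum of the primitive generators of the rays of `σ`, a lattice vector in the interior. -/
def interiorVec (σ : F.cones) : N := ∑ ρ : F.raysIn σ, ρ.1.1

lemma vec_interiorVec_mem (σ : F.cones) : vec (F.interiorVec σ) ∈ σ.1 := by
  have : vec (F.interiorVec σ) = ∑ ρ : F.raysIn σ, vec ρ.1.1 := TensorProduct.tmul_sum ..
  rw [this]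
  exact Submodule.sum_mem _ fun ρ _ => ρ.2

variable [Module.Finite ℤ N]

lemma apply_interiorVec_eq_zero {σ : F.cones} {χ : Module.Dual ℤ N} (hχ : χ ∈ dualMonoid σ.1) :
    χ (F.interiorVec σ) = 0 ↔ ∀ ρ : F.raysIn σ, χ ρ.1.1 = 0 := by
  rw [interiorVec, map_sum, Finset.sum_eq_zero_iff_of_nonneg fun ρ _ =>
    (F.mem_dualMonoid_iff σ χ).1 hχ ρ]
  simp

/-- If `X` is `ℚ`-factorial, then some element of `ℂ[S_σ]` vanishes along `D_ρ`, but along no other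
`D_ρ'`, and divides in `ℂ[M]` an element that does not vanish at the generic point of the minimal
orbit of `U_σ`. -/
lemma exists_local_equation (hF : IsQFactorial F.toricVariety) (σ : F.cones) {ρ ρ₁ : F.raysIn σ}
    (hρ₁ : ρ₁ ≠ ρ) :
    ∃ a : ℂ[dualMonoid σ.1], a ∈ orbitIdeal σ.1 ρ.1.1 ρ.2 ∧
      (∀ ρ' : F.raysIn σ, ρ' ≠ ρ → a ∉ orbitIdeal σ.1 ρ'.1.1 ρ'.2) ∧
      ∃ (h : ℂ[dualMonoid (⊥ : PointedCone ℚ (ℚ ⊗[ℤ] N))]) (c : ℂ[dualMonoid σ.1]),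
        c ∉ orbitIdeal σ.1 (F.interiorVec σ) (F.vec_interiorVec_mem σ) ∧
        inclHom (dualMonoid_anti bot_le) a * h = inclHom (dualMonoid_anti bot_le) c := by
  let p : affineChart σ.1 := orbitPoint σ.1 (F.interiorVec σ) (F.vec_interiorVec_mem σ)
  obtain ⟨n, hn, hX⟩ := hF _ (F.coheight_divisor ρ.1)
  obtain ⟨W, hpW, f, hf⟩ := hX (F.chart σ p)
  obtain ⟨a, b, hb, hab⟩ := Scheme.exists_isUnit_germ_iff (F.chart σ) p W hpW f
  -- The point `p` lies on every `D_ρ'`, so the denominator `b`, nonzero at `p`, vanishes along none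
  -- of them.
  have hle : ∀ ρ' : F.raysIn σ, orbitIdeal σ.1 ρ'.1.1 ρ'.2 ≤
      orbitIdeal σ.1 (F.interiorVec σ) (F.vec_interiorVec_mem σ) := fun ρ' g hg χ hχ =>
    hg χ ((F.apply_interiorVec_eq_zero χ.2).1 hχ ρ')
  have hdiv : ∀ ρ' : F.raysIn σ, b ∉ (orbitPoint σ.1 ρ'.1.1 ρ'.2).asIdeal :=
    fun ρ' h => hb (hle ρ' h)
  have ha : a ∈ orbitIdeal σ.1 ρ.1.1 ρ.2 := by
    obtain ⟨hy, h⟩ := hab _ (hdiv ρ)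
    have hy1 := F.divisor_eq σ ρ.1 ρ.2
    have h1 := (hf _ hy (by rw [← hy1]; exact F.coheight_divisor ρ.1)).1 hy1.symm
    have h2 := IsLocalRing.not_isUnit_of_span_eq_pow hn h1
    rw [h, not_not] at h2
    exact h2
  have ha' : ∀ ρ' : F.raysIn σ, ρ' ≠ ρ → a ∉ orbitIdeal σ.1 ρ'.1.1 ρ'.2 := by
    intro ρ' hne
    obtain ⟨hy, h⟩ := hab _ (hdiv ρ')
    have hy1 := F.divisor_eq σ ρ'.1 ρ'.2
    refine h.1 ((hf _ hy (by rw [← hy1]; exact F.coheight_divisor ρ'.1)).2 ?_)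
    rw [← hy1]
    exact fun h => hne (Subtype.ext (F.divisor_injective h))
  refine ⟨a, ha, ha', ?_⟩
  let ι := inclHom (dualMonoid_anti (bot_le : ⊥ ≤ σ.1))
  have hι : Function.Injective ι :=
    mapDomain_injective (AddSubmonoid.inclusion_injective (dualMonoid_anti bot_le))
  -- The second ray `ρ₁` guarantees `a ≠ 0`, because `a` does not vanish along its divisor.
  have ha0 : ι a ≠ 0 := by
    intro h
    rw [← map_zero ι] at h
    exact ha' ρ₁ hρ₁ (hι h ▸ zero_mem _)
  have hp : p.asIdeal.IsPrime := p.2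
  let S : Submonoid ℂ[dualMonoid (⊥ : PointedCone ℚ (ℚ ⊗[ℤ] N))] := p.asIdeal.primeCompl.map ι
  -- A prime `Q` of height one on the torus that is disjoint from `S` gives a divisor through `p`
  -- other than `D_ρ`, which misses the torus. There the local equation is a unit, so `a ∉ Q`.
  obtain ⟨h, hS⟩ := exists_mul_mem_of_forall_height_one ha0 S fun Q hQ hQ1 hQS haQ => by
    let τ : F.cones := ⟨⊥, F.bot_mem_cones⟩
    let y : affineChart τ.1 := ⟨Q, hQ⟩
    let z : affineChart σ.1 := affineMap bot_le y
    have hz : ∀ g : ℂ[dualMonoid σ.1], g ∈ z.asIdeal ↔ ι g ∈ Q := fun g => Iff.rfl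
    have hzp : b ∉ z.asIdeal := by
      rw [hz]
      exact fun h => Set.disjoint_left.1 hQS h
          (Submonoid.mem_map_of_mem ι (show b ∈ p.asIdeal.primeCompl from hb))
    obtain ⟨hy, h⟩ := hab z hzp
    have hy0 : F.chart σ z = F.chart τ y := F.chart_affineMap (τ := τ) bot_le y
    have hy1 : Order.coheight (F.chart σ z) = 1 := by
      rw [hy0, coheight_chart]
      exact hQ1
    refine h.1 ((hf _ hy hy1).2 fun h => ?_) haQ
    rw [hy0] at h
    have h2 : vec ρ.1.1 ∈ (⊥ : PointedCone ℚ (ℚ ⊗[ℤ] N)) := F.mem_raysIn_of_divisor_eq h.symm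
    rw [Submodule.mem_bot] at h2
    obtain ⟨χ, hχ⟩ := ρ.1.2.1.exists_dual_eq_one
    have h3 := congrArg (pairing χ) h2
    rw [pairing_vec, hχ, map_zero] at h3
    norm_num at h3
  obtain ⟨c, hc, hch⟩ := Submonoid.mem_map.1 hS
  exact ⟨h, c, hc, hch.symm⟩

/-- The required character is the exponent of a lowest term of the local equation `a` of `D_ρ`,
taken in the direction of an interior vector of `σ`. The factorization `a h = c` on the torus makes
it vanish on the other rays. -/
lemma exists_dual_separating_ray (hF : IsQFactorial F.toricVariety) (σ : F.cones) (ρ : F.raysIn σ) :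
    ∃ χ : Module.Dual ℤ N, χ ρ.1.1 ≠ 0 ∧ ∀ ρ' : F.raysIn σ, ρ' ≠ ρ → χ ρ'.1.1 = 0 := by
  by_cases hone : ∃ ρ₁ : F.raysIn σ, ρ₁ ≠ ρ
  swap
  · push Not at hone
    obtain ⟨χ, hχ⟩ := ρ.1.2.1.exists_dual_eq_one
    exact ⟨χ, by rw [hχ]; exact one_ne_zero, fun ρ' h => absurd (hone ρ') h⟩
  obtain ⟨ρ₁, hρ₁⟩ := hone
  obtain ⟨a, ha, ha', h, c, hc, hch⟩ := F.exists_local_equation hF σ hρ₁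
  let T := dualMonoid (⊥ : PointedCone ℚ (ℚ ⊗[ℤ] N))
  let i : dualMonoid σ.1 →+ T := AddSubmonoid.inclusion (dualMonoid_anti bot_le)
  have hi : Function.Injective i := AddSubmonoid.inclusion_injective _
  let ι := inclHom (dualMonoid_anti (bot_le : ⊥ ≤ σ.1))
  have hcoeff : ∀ (g : ℂ[dualMonoid σ.1]) χ, (ι g).coeff (i χ) = g.coeff χ := fun g χ =>
    Finsupp.mapDomain_apply hi g.coeff χ
  have hsupp : ∀ (g : ℂ[dualMonoid σ.1]) (χ : T), (ι g).coeff χ ≠ 0 →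
      ∃ χ', i χ' = χ ∧ g.coeff χ' ≠ 0 := fun g χ hχ => by
    by_cases hr : χ ∈ Set.range i
    · obtain ⟨χ', rfl⟩ := hr
      exact ⟨χ', rfl, by rwa [hcoeff] at hχ⟩
    · exact absurd (Finsupp.mapDomain_of_notMem_range _ _ hr) hχ
  have hc0 : ι c ≠ 0 := fun h0 => hc (by
    have : c = 0 := mapDomain_injective hi (h0.trans (map_zero ι).symm)
    rw [this]; exact zero_mem _)
  have ha0 : ι a ≠ 0 := fun h0 => hc0 (by rw [← hch, h0, zero_mul])
  have hh0 : h ≠ 0 := fun h0 => hc0 (by rw [← hch, h0, mul_zero])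
  -- The lowest terms of `a` and `h` with respect to an interior vector.
  obtain ⟨α, β, hα, hα', hβ, hβ', hαβ⟩ :=
    exists_min_coeff_mul_ne_zero (evalAt ⊥ (F.interiorVec σ)) ha0 hh0
  rw [hch] at hαβ
  obtain ⟨α₀, rfl, hα₀⟩ := hsupp a α hα
  obtain ⟨γ, hγ, hγc⟩ := hsupp c _ hαβ
  have hsum : ∀ v, γ.1 v = α₀.1 v + β.1 v := fun v =>
    LinearMap.congr_fun (congrArg Subtype.val hγ) v
  -- Some exponent `δ` of `c` has value zero at the interior vector. It is a sum of exponents of `a`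
  -- and `h`, so the sum `γ` of lowest exponents has value at most zero, hence exactly zero.
  have hγ0 : ∀ ρ' : F.raysIn σ, γ.1 ρ'.1.1 = 0 := by
    rw [← F.apply_interiorVec_eq_zero γ.2]
    refine le_antisymm ?_ (evalAt_nonneg (F.vec_interiorVec_mem σ) γ)
    rw [mem_monomialIdeal] at hc
    push Not at hc
    obtain ⟨δ, hδ, hδc⟩ := hc
    rw [← hcoeff, ← hch] at hδc
    obtain ⟨α', β'', h1, h2, h3⟩ := exists_add_of_coeff_mul_ne_zero hδc
    have h4 := hα' _ h1
    have h5 := hβ' _ h2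
    have h6 : α'.1 (F.interiorVec σ) + β''.1 (F.interiorVec σ) = δ.1 (F.interiorVec σ) :=
      LinearMap.congr_fun (congrArg Subtype.val h3) _
    rw [evalAt_apply] at hδ
    rw [hδ] at h6
    rw [hsum]
    simp only [evalAt_apply] at h4 h5
    exact (add_le_add h4 h5).trans h6.le
  refine ⟨α₀.1, fun h0 => hα₀ (ha α₀ h0), fun ρ' hne => ?_⟩
  -- Now take lowest terms in the direction `u_ρ'`. The minimum for `a` is at most zero because `a`
  -- does not vanish along `D_ρ'`, and the minima for `a` and `h` add up to the value of an exponent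
  -- of `c`, which is nonnegative. So `β` is nonnegative at `u_ρ'`. Since `α₀` is nonnegative and
  -- `α₀ + β = γ` vanishes there, `α₀` vanishes there.
  obtain ⟨α₁, β₁, hα₁, hα₁', hβ₁, hβ₁', hαβ₁⟩ :=
    exists_min_coeff_mul_ne_zero (evalAt ⊥ ρ'.1.1) ha0 hh0
  rw [hch] at hαβ₁
  obtain ⟨γ₁, hγ₁, -⟩ := hsupp c _ hαβ₁
  have h1 : 0 ≤ γ₁.1 ρ'.1.1 := evalAt_nonneg ρ'.2 γ₁
  have h2 : γ₁.1 ρ'.1.1 = α₁.1 ρ'.1.1 + β₁.1 ρ'.1.1 :=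
    LinearMap.congr_fun (congrArg Subtype.val hγ₁) _
  have h3 : α₁.1 ρ'.1.1 ≤ 0 := by
    have := ha' ρ' hne
    rw [mem_monomialIdeal] at this
    push Not at this
    obtain ⟨δ, hδ, hδc⟩ := this
    rw [← hcoeff] at hδc
    exact (hα₁' _ hδc).trans hδ.le
  have h4 : β₁.1 ρ'.1.1 ≤ β.1 ρ'.1.1 := hβ₁' _ hβ
  have h5 : 0 ≤ α₀.1 ρ'.1.1 := evalAt_nonneg ρ'.2 α₀
  have h6 := hsum ρ'.1.1
  rw [hγ0] at h6
  omega

theorem linearIndependent_rays (hF : IsQFactorial F.toricVariety) (σ : F.cones) :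
    LinearIndependent ℚ (fun ρ : F.raysIn σ => vec ρ.1.1) := by
  rw [Fintype.linearIndependent_iff]
  intro c hc ρ
  obtain ⟨χ, hχ, hχ'⟩ := F.exists_dual_separating_ray hF σ ρ
  have h := congrArg (pairing χ) hc
  rw [map_sum, map_zero, Finset.sum_eq_single ρ] at h
  · rw [map_smul, pairing_vec, smul_eq_mul] at h
    exact (mul_eq_zero.1 h).resolve_right (by exact_mod_cast hχ)
  · intro ρ' _ hne
    rw [map_smul, pairing_vec, hχ' ρ' hne, Int.cast_zero, smul_zero]
  · simp

end Fan

/-! ### Ramification indices in terms of ideals -/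

/-- The ramification index along a morphism from an affine scheme to an affine open subscheme. -/
lemma hasRamificationIndex_iff {X : Scheme.{0}} {A B : Type} [CommRing A] [CommRing B]
    (φ : A →+* B) (j : Spec (CommRingCat.of A) ⟶ X) [IsOpenImmersion j]
    (y : PrimeSpectrum B) (e : ℕ) :
    HasRamificationIndex (V := Spec (CommRingCat.of B)) (Spec.map (CommRingCat.ofHom φ) ≫ j) y e ↔
      ((y.asIdeal.comap φ).map φ).map (algebraMap B (Localization.AtPrime y.asIdeal)) =
        y.asIdeal.map (algebraMap B (Localization.AtPrime y.asIdeal)) ^ e := by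
  let f := Spec.map (CommRingCat.ofHom φ)
  let q : PrimeSpectrum A := y.comap φ
  let z : Spec (CommRingCat.of B) := y
  let Oy := (Spec (CommRingCat.of B)).presheaf.stalk z
  let Oq := (Spec (CommRingCat.of A)).presheaf.stalk (f z)
  let Oj := X.presheaf.stalk ((f ≫ j) z)
  let ey : Oy ≃+* Localization.AtPrime y.asIdeal :=
    (Spec.stalkIso (CommRingCat.of B) y).commRingCatIsoToRingEquiv
  let eq : Oq ≃+* Localization.AtPrime q.asIdeal :=
    (Spec.stalkIso (CommRingCat.of A) q).commRingCatIsoToRingEquiv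
  let ej : Oj ≃+* Oq := (asIso (j.stalkMap (f z))).commRingCatIsoToRingEquiv
  let l := Localization.localRingHom q.asIdeal y.asIdeal φ rfl
  -- Up to isomorphisms of local rings, the stalk map is the localization of `φ` at `y`, since the
  -- open immersion does not change stalks.
  have h : ((f ≫ j).stalkMap z).hom = (ey.symm : Localization.AtPrime y.asIdeal →+* Oy).comp
      (l.comp ((eq : Oq →+* Localization.AtPrime q.asIdeal).comp (ej : Oj →+* Oq))) := by
    refine (congrArg CommRingCat.Hom.hom ((Scheme.Hom.stalkMap_comp f j z).trans
      (congrArg (fun g => j.stalkMap (f z) ≫ g)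
        (Scheme.localRingHom_comp_stalkIso (CommRingCat.ofHom φ) y).symm))).trans ?_
    rfl
  have hmap : Ideal.map ((f ≫ j).stalkMap z).hom
      (IsLocalRing.maximalIdeal Oj) =
      (((y.asIdeal.comap φ).map φ).map (algebraMap B (Localization.AtPrime y.asIdeal))).map
        (ey.symm : Localization.AtPrime y.asIdeal →+* Oy) := by
    rw [h, ← Ideal.map_map, ← Ideal.map_map, ← Ideal.map_map]
    congr 1
    have h3 : Ideal.map (ej : Oj →+* Oq) (IsLocalRing.maximalIdeal Oj) =
        IsLocalRing.maximalIdeal Oq := IsLocalRing.map_ringEquiv_maximalIdeal ej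
    have h4 : Ideal.map (eq : Oq →+* Localization.AtPrime q.asIdeal) (IsLocalRing.maximalIdeal Oq) =
        IsLocalRing.maximalIdeal (Localization.AtPrime q.asIdeal) :=
      IsLocalRing.map_ringEquiv_maximalIdeal eq
    refine (congrArg (fun I =>
      Ideal.map l (Ideal.map (eq : Oq →+* Localization.AtPrime q.asIdeal) I)) h3).trans ?_
    refine (congrArg (Ideal.map l) h4).trans ?_
    refine (congrArg (Ideal.map l) Localization.AtPrime.map_eq_maximalIdeal.symm).trans ?_
    rw [Ideal.map_map, Ideal.map_map]
    refine congrArg (fun g => Ideal.map g (y.asIdeal.comap φ)) (RingHom.ext fun a => ?_)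
    exact Localization.localRingHom_to_map q.asIdeal y.asIdeal φ rfl a
  have hy : (y.asIdeal.map (algebraMap B (Localization.AtPrime y.asIdeal)) ^ e).map
      (ey.symm : Localization.AtPrime y.asIdeal →+* Oy) = IsLocalRing.maximalIdeal Oy ^ e := by
    rw [Ideal.map_pow, Localization.AtPrime.map_eq_maximalIdeal]
    exact congrArg (· ^ e) (IsLocalRing.map_ringEquiv_maximalIdeal ey.symm)
  change Ideal.map ((f ≫ j).stalkMap z).hom
      (IsLocalRing.maximalIdeal Oj) = IsLocalRing.maximalIdeal Oy ^ e ↔ _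
  rw [hmap, ← hy]
  refine ⟨fun h => ?_, fun h => by rw [h]⟩
  have hid : (ey : Oy →+* Localization.AtPrime y.asIdeal).comp
      (ey.symm : Localization.AtPrime y.asIdeal →+* Oy) = RingHom.id _ :=
    RingHom.ext ey.apply_symm_apply
  have hinv : ∀ I, Ideal.map (ey : Oy →+* Localization.AtPrime y.asIdeal)
      (Ideal.map (ey.symm : Localization.AtPrime y.asIdeal →+* Oy) I) = I := fun I => by
    rw [Ideal.map_map, hid, Ideal.map_id]
  have h5 := congrArg (Ideal.map (ey : Oy →+* Localization.AtPrime y.asIdeal)) h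
  exact (hinv _).symm.trans (h5.trans (hinv _))

/-! ### Unramified primes and smoothness of mixed Laurent algebras -/

namespace AddMonoidAlgebra

/-- Let `φ : A → ℂ[E]` be such that a common multiple of every exponent comes from `A`. Then
`φ` is unramified at the primes without monomials. -/
lemma map_comap_eq_of_single_notMem {A E : Type} [CommRing A] [Algebra ℂ A] [AddCommMonoid E]
    [AddMonoid.FG E] (φ : A →+* ℂ[E]) (hφ : φ.comp (algebraMap ℂ A) = algebraMap ℂ ℂ[E])
    {K : ℕ} (hK : 0 < K) (hE : ∀ e : E, ∃ a, φ a = single (K • e) 1)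
    (y : Ideal ℂ[E]) [y.IsPrime] (hy : ∀ e : E, single e 1 ∉ y) :
    ((y.comap φ).map φ).map (algebraMap ℂ[E] (Localization.AtPrime y)) =
      y.map (algebraMap ℂ[E] (Localization.AtPrime y)) := by
  let q := y.comap φ
  let R := Localization.AtPrime q
  let S := Localization.AtPrime y
  let l : R →+* S := Localization.localRingHom q y φ rfl
  let _ : Algebra R S := l.toAlgebra
  have hl : ∀ a, algebraMap R S (algebraMap A R a) = algebraMap ℂ[E] S (φ a) := fun a =>
    Localization.localRingHom_to_map q y φ rfl a
  have : IsLocalHom (algebraMap R S) := Localization.isLocalHom_localRingHom q y φ rfl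
  have : IsScalarTower ℂ R S := IsScalarTower.of_algebraMap_eq fun c => by
    rw [IsScalarTower.algebraMap_apply ℂ A R, hl, ← RingHom.comp_apply φ, hφ,
      ← IsScalarTower.algebraMap_apply]
  have : Algebra.EssFiniteType ℂ[E] S := Algebra.EssFiniteType.of_isLocalization S y.primeCompl
  have : Algebra.EssFiniteType ℂ S := Algebra.EssFiniteType.comp ℂ ℂ[E] S
  have : Algebra.EssFiniteType R S := Algebra.EssFiniteType.of_comp ℂ R S
  have hD : ∀ b : ℂ[E], KaehlerDifferential.D R S (algebraMap ℂ[E] S b) = 0 := by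
    intro b
    induction b using AddMonoidAlgebra.induction_linear with
    | zero => simp
    | add f g hf hg => rw [map_add, map_add, hf, hg, add_zero]
    | single e c =>
      have hs : single e c = φ (algebraMap ℂ A c) * single e 1 := by
        rw [← RingHom.comp_apply φ, hφ]
        simp [single_mul_single]
      have hu : IsUnit (algebraMap ℂ[E] S (single e 1)) :=
        IsLocalization.map_units S (⟨_, hy e⟩ : y.primeCompl)
      obtain ⟨a, ha⟩ := hE e
      -- The `K`-th power comes from `A`, so its differential `K s ^ (K - 1) ds` is zero. Here `s`
      -- is a unit at `y` and `K` is invertible in characteristic zero, so `ds = 0`.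
      have h1 : algebraMap ℂ[E] S (single e 1) ^ K = algebraMap R S (algebraMap A R a) := by
        rw [hl, ha, ← map_pow, single_pow, one_pow]
      have h2 := congrArg (KaehlerDifferential.D R S) h1
      rw [Derivation.map_algebraMap, Derivation.leibniz_pow, ← Nat.cast_smul_eq_nsmul S,
        smul_smul] at h2
      have h3 : IsUnit ((K : S) * algebraMap ℂ[E] S (single e 1) ^ (K - 1)) := by
        refine IsUnit.mul ?_ (hu.pow _)
        have : (K : S) = algebraMap ℂ S K := (map_natCast _ _).symm
        rw [this]
        exact (IsUnit.mk0 (K : ℂ) (by exact_mod_cast hK.ne')).map _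
      have h4 : KaehlerDifferential.D R S (algebraMap ℂ[E] S (single e 1)) = 0 :=
        (h3.smul_eq_zero).1 h2
      rw [hs, map_mul, ← hl, Derivation.leibniz, h4, Derivation.map_algebraMap, smul_zero,
        smul_zero, add_zero]
  have hD' : ∀ s : S, KaehlerDifferential.D R S s = 0 := by
    intro s
    obtain ⟨⟨b, t⟩, hs⟩ := IsLocalization.surj y.primeCompl s
    have h1 := congrArg (KaehlerDifferential.D R S) hs
    rw [Derivation.leibniz, hD, hD, smul_zero, zero_add] at h1
    exact ((IsLocalization.map_units S t).smul_eq_zero).1 h1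
  have : Algebra.FormallyUnramified R S := by
    constructor
    rw [← Submodule.subsingleton_iff S, ← subsingleton_iff_bot_eq_top,
      ← KaehlerDifferential.span_range_derivation, eq_comm, Submodule.span_eq_bot]
    rintro _ ⟨s, rfl⟩
    exact hD' s
  -- For a local extension essentially of finite type, vanishing of the relative differentials says
  -- that the maximal ideal downstairs generates the one upstairs.
  have h := Algebra.FormallyUnramified.map_maximalIdeal (R := R) (S := S)
  have hA := Localization.AtPrime.map_eq_maximalIdeal (I := q)
  have hB := Localization.AtPrime.map_eq_maximalIdeal (I := y)
  rw [Ideal.map_map, hB, ← h, ← hA, Ideal.map_map]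
  exact congrArg (fun g => Ideal.map g q) (RingHom.ext fun a => (hl a).symm)

lemma eq_sum_single {A : Type} (f : ℂ[A]) :
    f = ∑ a ∈ f.coeff.support, single a (f.coeff a) := by
  refine coeff_injective (f.coeff.sum_single.symm.trans ?_)
  rw [coeff_sum]
  rfl

lemma fg_mixedExponents {I J : Type} [Finite I] [Finite J] :
    AddMonoid.FG ((I → ℕ) × (J → ℤ)) := by
  rw [← Module.Finite.iff_addMonoid_fg]
  have : Module.Finite ℕ (J → ℤ) := by
    have h : AddGroup.FG (J → ℤ) := by
      rw [← Module.Finite.iff_addGroup_fg]; infer_instance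
    rw [AddGroup.fg_iff_addMonoid_fg] at h
    infer_instance
  infer_instance

/-- The algebra `ℂ[x_i, t_j^{±1}]` is smooth. -/
lemma smooth_mixedLaurent {I J : Type} [Finite I] [Finite J] :
    Algebra.Smooth ℂ ℂ[(I → ℕ) × (J → ℤ)] := by
  have hfg := fg_mixedExponents (I := I) (J := J)
  have hfin : Algebra.FinitePresentation ℂ ℂ[(I → ℕ) × (J → ℤ)] :=
    Algebra.FinitePresentation.of_finiteType.1 inferInstance
  -- Lift along a square-zero ideal: the images of the `x_i` lift arbitrarily, and those of the
  -- `t_j` lift to units because units lift modulo nilpotents. As `ℕ^I` and `ℤ^J` are free, lifts of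
  -- the basis vectors determine lifts of all monomials.
  refine ⟨Algebra.FormallySmooth.of_comp_surjective fun C _ _ 𝔞 h𝔞 f => ?_, hfin⟩
  classical
  have := Fintype.ofFinite I
  have := Fintype.ofFinite J
  let π := Ideal.Quotient.mk 𝔞
  have hπ : Function.Surjective π := Ideal.Quotient.mk_surjective
  have hunit : ∀ c, IsUnit (π c) → IsUnit c := fun c h =>
    (IsNilpotent.isUnit_quotient_mk_iff (I := 𝔞) ⟨2, h𝔞⟩).1 h
  let x : I → C := fun i => Function.surjInv hπ (f (single (Pi.single i 1, 0) 1))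
  have hx : ∀ i, π (x i) = f (single (Pi.single i 1, 0) 1) := fun i => Function.surjInv_eq hπ _
  let t₀ : Multiplicative (J → ℤ) →* (C ⧸ 𝔞) :=
    { toFun := fun e => f (single (0, e.toAdd) 1)
      map_one' := map_one f
      map_mul' := fun e e' => by
        rw [← map_mul, single_mul_single]
        simp }
  let t₁ : Multiplicative (J → ℤ) →* (C ⧸ 𝔞)ˣ := t₀.toHomUnits
  have ht : ∀ j, ∃ u : Cˣ, π u = t₁ (Multiplicative.ofAdd (Pi.single j 1)) := fun j => by
    obtain ⟨c, hc⟩ := hπ (t₁ (Multiplicative.ofAdd (Pi.single j 1)))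
    obtain ⟨u, rfl⟩ := hunit c (hc ▸ Units.isUnit _)
    exact ⟨u, hc⟩
  choose t ht using ht
  let X : (I → ℕ) →ₗ[ℕ] Additive C := (Pi.basisFun ℕ I).constr ℕ fun i => Additive.ofMul (x i)
  let T : (J → ℤ) →ₗ[ℤ] Additive Cˣ := (Pi.basisFun ℤ J).constr ℤ fun j => Additive.ofMul (t j)
  have hX : ∀ e, π (X e).toMul = f (single (e, 0) 1) := by
    let X₁ : (I → ℕ) →ₗ[ℕ] Additive (C ⧸ 𝔞) := AddMonoidHom.toNatLinearMap
      { toFun := fun e => Additive.ofMul (f (single (e, 0) 1))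
        map_zero' := congrArg Additive.ofMul (map_one f)
        map_add' := fun e e' => by
          rw [← ofMul_mul, ← map_mul, single_mul_single]
          simp }
    let X₂ : (I → ℕ) →ₗ[ℕ] Additive (C ⧸ 𝔞) :=
      (MonoidHom.toAdditive (π : C →* C ⧸ 𝔞)).toNatLinearMap ∘ₗ X
    have : X₂ = X₁ := (Pi.basisFun ℕ I).ext fun i => by
      change Additive.ofMul (π (X (Pi.basisFun ℕ I i)).toMul) = _
      rw [Module.Basis.constr_basis, Pi.basisFun_apply]
      exact congrArg Additive.ofMul (hx i)
    exact fun e => congrArg Additive.toMul (LinearMap.congr_fun this e)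
  have hT : ∀ e, π ((T e).toMul : Cˣ) = f (single (0, e) 1) := by
    let T₁ : (J → ℤ) →ₗ[ℤ] Additive (C ⧸ 𝔞)ˣ := (MonoidHom.toAdditiveRight t₁).toIntLinearMap
    let T₂ : (J → ℤ) →ₗ[ℤ] Additive (C ⧸ 𝔞)ˣ :=
      (MonoidHom.toAdditive (Units.map (π : C →* C ⧸ 𝔞))).toIntLinearMap ∘ₗ T
    have : T₂ = T₁ := (Pi.basisFun ℤ J).ext fun j => by
      change Additive.ofMul (Units.map (π : C →* C ⧸ 𝔞) (T (Pi.basisFun ℤ J j)).toMul) = _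
      rw [Module.Basis.constr_basis, Pi.basisFun_apply]
      exact congrArg Additive.ofMul (Units.ext (ht j))
    exact fun e => congrArg (fun u : Additive (C ⧸ 𝔞)ˣ => (u.toMul : C ⧸ 𝔞))
      (LinearMap.congr_fun this e)
  refine ⟨AddMonoidAlgebra.lift ℂ _ _
    { toFun := fun e => (X e.toAdd.1).toMul * ((T e.toAdd.2).toMul : Cˣ)
      map_one' := by simp
      map_mul' := fun e e' => by
        simp only [toAdd_mul, Prod.fst_add, Prod.snd_add, map_add, toMul_add, Units.val_mul]
        ring }, ?_⟩
  refine AddMonoidAlgebra.algHom_ext (fun e => ?_) (Subsingleton.elim _ _)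
  rw [AlgHom.comp_apply, AddMonoidAlgebra.lift_single, one_smul]
  change π (_ * _) = _
  rw [map_mul, hX, hT, ← map_mul, single_mul_single]
  simp

end AddMonoidAlgebra

/-! ### The quotient of the log Cox construction by `H` -/

namespace Toric

variable {N : Type} [AddCommGroup N]

lemma dual_eq_zero_of_span {ι : Type} {g : ι → N}
    (hg : Submodule.span ℚ (Set.range fun i => vec (g i)) = ⊤) {χ : Module.Dual ℤ N}
    (hχ : ∀ i, χ (g i) = 0) : χ = 0 := by
  have h : pairing χ = 0 := LinearMap.ext_on_range (v := fun i => vec (g i)) hg fun i => by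
    rw [pairing_vec, hχ, Int.cast_zero, LinearMap.zero_apply]
  ext v
  have := LinearMap.congr_fun h (vec v)
  rw [pairing_vec, LinearMap.zero_apply] at this
  exact_mod_cast this

variable [Module.Free ℤ N] [Module.Finite ℤ N]

/-- Up to a common factor, the values of a character on lattice vectors that form a basis of `N_ℚ`
can be prescribed. -/
lemma exists_dual_apply_eq {ι : Type} [Finite ι] {g : ι → N}
    (hg : LinearIndependent ℚ fun i => vec (g i)) :
    ∃ k : ℕ, 0 < k ∧ ∀ z : ι → ℤ, ∃ χ : Module.Dual ℤ N, ∀ i, χ (g i) = k * z i := by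
  classical
  have := Fintype.ofFinite ι
  have h1 : ∀ i, ∃ (k : ℕ) (χ : Module.Dual ℤ N), 0 < k ∧ χ (g i) = k ∧
      ∀ j, j ≠ i → χ (g j) = 0 := fun i => by
    let b := Module.Basis.span hg
    obtain ⟨φ, hφ'⟩ := LinearMap.exists_extend (b.coord i)
    have hφ : ∀ j, φ (vec (g j)) = Pi.single (M := fun _ => ℚ) i 1 j := fun j => by
      have h := LinearMap.congr_fun hφ' (b j)
      have hb : ((b j : Submodule.span ℚ (Set.range fun i => vec (g i))) : ℚ ⊗[ℤ] N) =
        vec (g j) := congrArg Subtype.val (Module.Basis.span_apply hg j)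
      rw [LinearMap.comp_apply, Submodule.subtype_apply, hb, Module.Basis.coord_apply,
        Module.Basis.repr_self, Finsupp.single_apply] at h
      rw [h, Pi.single_apply]
    obtain ⟨k, χ, hk, hχ⟩ := exists_pairing_eq_smul φ
    refine ⟨k, χ, hk, ?_, fun j hj => ?_⟩
    · have := hχ (vec (g i))
      rw [pairing_vec, hφ, Pi.single_eq_same, mul_one] at this
      exact_mod_cast this
    · have := hχ (vec (g j))
      rw [pairing_vec, hφ, Pi.single_eq_of_ne hj, mul_zero] at this
      exact_mod_cast this
  choose k χ hk hχ hχ' using h1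
  have h2 : ∀ i, ∃ l : ℕ, ∏ i, k i = k i * l := fun i =>
    Finset.dvd_prod_of_mem k (Finset.mem_univ i)
  choose l hl using h2
  refine ⟨∏ i, k i, Finset.prod_pos fun i _ => hk i, fun z => ⟨∑ i, (l i * z i) • χ i, fun i => ?_⟩⟩
  rw [LinearMap.sum_apply, Finset.sum_eq_single i]
  · rw [LinearMap.smul_apply, hχ, hl i, smul_eq_mul]
    push_cast
    ring
  · intro j _ hj
    rw [LinearMap.smul_apply, hχ' j i hj.symm, smul_zero]
  · simp

end Toric

namespace Fan

open Toric AddMonoidAlgebra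

variable {N : Type} [AddCommGroup N] (F : Fan N) (m : F.rays → ℕ) (σ : F.cones) {J : Type}
  (w : J → N)

/-- The exponents of the images of the characters in `S_σ` in the log Cox ring. -/
def coxExponent : dualMonoid σ.1 →+ (F.raysIn σ → ℕ) × (J → ℤ) where
  toFun := fun χ => (fun ρ => ((F.coxMap m σ w χ).1 ρ).toNat, (F.coxMap m σ w χ).2)
  map_zero' := by ext <;> simp
  map_add' := fun χ χ' => by
    ext ρ
    · have h := F.apply_nonneg_of_mem_raysIn m σ χ ρ
      have h' := F.apply_nonneg_of_mem_raysIn m σ χ' ρ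
      simp only [AddSubmonoid.coe_add, map_add]
      exact Int.toNat_add h h'
    · simp

lemma coxHom_single (χ : dualMonoid σ.1) (c : ℂ) :
    F.coxHom m σ w (single χ c) = single (F.coxExponent m σ w χ) c := mapDomain_single

lemma coxHom_comp_algebraMap :
    (F.coxHom m σ w).comp (algebraMap ℂ ℂ[dualMonoid σ.1]) = algebraMap ℂ (F.coxRing σ J) :=
  mapDomainRingHom_comp_algebraMap _

lemma coxExponent_fst (χ : dualMonoid σ.1) (ρ : F.raysIn σ) :
    (((F.coxExponent m σ w χ).1 ρ : ℕ) : ℤ) = m ρ.1 * χ.1 ρ.1.1 := by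
  have h := F.apply_nonneg_of_mem_raysIn m σ χ ρ
  refine (Int.toNat_of_nonneg h).trans ?_
  rw [map_smul, smul_eq_mul]

lemma coxAction_single (g : F.coxGroup m σ w) (a : (F.raysIn σ → ℕ) × (J → ℤ)) (c : ℂ) :
    F.coxAction m σ w g (single a c) = single a (g (F.coxDegree m σ w a) * c) := by
  refine (AddMonoidAlgebra.lift_single _ _ _).trans ?_
  change c • single a (g (F.coxDegree m σ w a)) = _
  rw [AddMonoidAlgebra.smul_single, smul_eq_mul, mul_comm]

lemma coeff_coxAction (g : F.coxGroup m σ w) (f : F.coxRing σ J)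
    (a : (F.raysIn σ → ℕ) × (J → ℤ)) :
    (F.coxAction m σ w g f).coeff a = g (F.coxDegree m σ w a) * f.coeff a := by
  classical
  induction f using AddMonoidAlgebra.induction_linear with
  | zero => simp
  | add f f' hf hf' =>
    rw [map_add, coeff_add, coeff_add, Finsupp.add_apply, Finsupp.add_apply, hf, hf', mul_add]
  | single b c =>
    rw [coxAction_single, coeff_single, coeff_single, Finsupp.single_apply, Finsupp.single_apply]
    by_cases h : b = a
    · rw [if_pos h, if_pos h, h]
    · rw [if_neg h, if_neg h, mul_zero]

lemma coxMorphism_structureMap : F.coxMorphism m σ w ≫ F.structureMap =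
    Spec.map (CommRingCat.ofHom (algebraMap ℂ (F.coxRing σ J))) := by
  have h1 : F.chart σ ≫ F.structureMap =
      Spec.map (CommRingCat.ofHom (algebraMap ℂ ℂ[dualMonoid σ.1])) :=
    Limits.colimit.ι_desc _ _
  rw [coxMorphism, Category.assoc, h1, ← Spec.map_comp, ← CommRingCat.ofHom_comp,
    coxHom_comp_algebraMap]

lemma mem_invariants_iff {B : Type} [CommRing B] [Algebra ℂ B] {G : Type} [Group G]
    (act : G →* (B →ₐ[ℂ] B)) (b : B) : b ∈ invariants act ↔ ∀ g, act g b = b := by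
  rw [invariants, Algebra.mem_iInf]
  exact forall_congr' fun g => Iff.rfl

/-- The lattice vectors `u_ρ` and `w_j` form a `ℚ`-basis of `N_ℚ`. -/
structure IsCompletion : Prop where
  linearIndependent : LinearIndependent ℚ
    (Sum.elim (fun ρ : F.raysIn σ => vec ρ.1.1) (fun j => vec (w j)))
  span_eq_top : Submodule.span ℚ (Set.range
    (Sum.elim (fun ρ : F.raysIn σ => vec ρ.1.1) (fun j => vec (w j)))) = ⊤

lemma sumElim_vec : Sum.elim (fun ρ : F.raysIn σ => vec ρ.1.1) (fun j => vec (w j)) =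
    fun i => vec (Sum.elim (fun ρ : F.raysIn σ => ρ.1.1) w i) := by
  ext i; cases i <;> rfl

namespace IsCompletion

variable {F m σ w}

lemma coxMap_injective (h : F.IsCompletion σ w) (hm : ∀ ρ, 0 < m ρ) :
    Function.Injective (F.coxMap m σ w) := by
  refine (injective_iff_map_eq_zero _).2 fun χ hχ => ?_
  have h1 := h.span_eq_top
  rw [sumElim_vec] at h1
  refine dual_eq_zero_of_span h1 fun i => ?_
  cases i with
  | inl ρ =>
    have h2 : χ ((m ρ.1 : ℤ) • ρ.1.1) = 0 := congrFun (congrArg Prod.fst hχ) ρ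
    rw [map_smul, smul_eq_mul, mul_eq_zero] at h2
    exact h2.resolve_left (by exact_mod_cast (hm _).ne')
  | inr j => exact congrFun (congrArg Prod.snd hχ) j

lemma coxExponent_injective (h : F.IsCompletion σ w) (hm : ∀ ρ, 0 < m ρ) :
    Function.Injective (F.coxExponent m σ w) := by
  intro χ χ' hχ
  refine Subtype.ext (h.coxMap_injective hm (Prod.ext (funext fun ρ => ?_)
    (show (F.coxExponent m σ w χ).2 = (F.coxExponent m σ w χ').2 from congrArg Prod.snd hχ)))
  have h1 := congrFun (congrArg Prod.fst hχ) ρ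
  have h2 := F.coxExponent_fst m σ w χ ρ
  have h3 := F.coxExponent_fst m σ w χ' ρ
  rw [h1] at h2
  change χ.1 ((m ρ.1 : ℤ) • ρ.1.1) = χ'.1 ((m ρ.1 : ℤ) • ρ.1.1)
  rw [map_smul, map_smul, smul_eq_mul, smul_eq_mul, ← h2, ← h3]

lemma coxHom_injective (h : F.IsCompletion σ w) (hm : ∀ ρ, 0 < m ρ) :
    Function.Injective (F.coxHom m σ w) :=
  mapDomain_injective (h.coxExponent_injective hm)

variable [Module.Finite ℤ N]

lemma finite (h : F.IsCompletion σ w) : Finite J :=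
  (h.linearIndependent.comp Sum.inr Sum.inr_injective).finite

variable [Module.Free ℤ N]

/-- A character whose exponents are nonnegative lies in `S_σ`. -/
lemma exists_coxExponent_eq (hm : ∀ ρ, 0 < m ρ) {a : (F.raysIn σ → ℕ) × (J → ℤ)}
    {χ : Module.Dual ℤ N} (hχ : F.coxMap m σ w χ = (fun ρ => (a.1 ρ : ℤ), a.2)) :
    ∃ χ' : dualMonoid σ.1, χ'.1 = χ ∧ F.coxExponent m σ w χ' = a := by
  have h1 : ∀ ρ : F.raysIn σ, (m ρ.1 : ℤ) * χ ρ.1.1 = a.1 ρ := fun ρ => by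
    rw [← smul_eq_mul, ← map_smul]
    exact congrFun (congrArg Prod.fst hχ) ρ
  refine ⟨⟨χ, (F.mem_dualMonoid_iff σ χ).2 fun ρ => ?_⟩, rfl,
    Prod.ext (funext fun ρ => ?_) (show (F.coxMap m σ w χ).2 = a.2 from congrArg Prod.snd hχ)⟩
  · have := h1 ρ
    have h2 : 0 ≤ (m ρ.1 : ℤ) * χ ρ.1.1 := by omega
    exact nonneg_of_mul_nonneg_right h2 (by exact_mod_cast hm _)
  · have h2 := F.coxExponent_fst m σ w ⟨χ, (F.mem_dualMonoid_iff σ χ).2 fun ρ => by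
      have := h1 ρ
      have h2 : 0 ≤ (m ρ.1 : ℤ) * χ ρ.1.1 := by omega
      exact nonneg_of_mul_nonneg_right h2 (by exact_mod_cast hm _)⟩ ρ
    exact_mod_cast h2.trans (h1 ρ)

/-- Rationally `P^*` is onto, and `K` is a common denominator: `k` clears the values prescribed on
the basis `u_ρ, w_j`, and `∏ m_ρ` clears the division by `m_ρ` that turns a value at `m_ρ u_ρ` into
one at `u_ρ`. -/
lemma exists_coxMap_eq_smul (h : F.IsCompletion σ w) (hm : ∀ ρ, 0 < m ρ) :
    ∃ K : ℕ, 0 < K ∧ ∀ z, ∃ χ, F.coxMap m σ w χ = K • z := by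
  have := h.finite
  have h1 := h.linearIndependent
  rw [sumElim_vec] at h1
  obtain ⟨k, hk, h2⟩ := exists_dual_apply_eq h1
  have h3 : ∀ ρ, ∃ l : ℕ, ∏ ρ, m ρ = m ρ * l := fun ρ =>
    Finset.dvd_prod_of_mem m (Finset.mem_univ ρ)
  choose l hl using h3
  refine ⟨k * ∏ ρ, m ρ, Nat.mul_pos hk (Finset.prod_pos fun ρ _ => hm ρ), fun z => ?_⟩
  obtain ⟨χ, hχ⟩ := h2 (Sum.elim (fun ρ => l ρ.1 * z.1 ρ) fun j => ((∏ ρ, m ρ : ℕ) : ℤ) * z.2 j)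
  refine ⟨χ, Prod.ext (funext fun ρ => ?_) (funext fun j => ?_)⟩
  · have h4 : χ ρ.1.1 = k * (l ρ.1 * z.1 ρ) := hχ (Sum.inl ρ)
    change χ ((m ρ.1 : ℤ) • ρ.1.1) = (k * ∏ ρ, m ρ) • z.1 ρ
    rw [map_smul, h4, hl ρ.1, nsmul_eq_mul, smul_eq_mul]
    push_cast
    ring
  · have h4 : χ (w j) = k * (((∏ ρ, m ρ : ℕ) : ℤ) * z.2 j) := hχ (Sum.inr j)
    change χ (w j) = (k * ∏ ρ, m ρ) • z.2 j
    rw [h4, nsmul_eq_mul]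
    push_cast
    ring

lemma exists_coxExponent_eq_smul (h : F.IsCompletion σ w) (hm : ∀ ρ, 0 < m ρ) :
    ∃ K : ℕ, 0 < K ∧ ∀ a, ∃ χ, F.coxExponent m σ w χ = K • a := by
  obtain ⟨K, hK, h1⟩ := h.exists_coxMap_eq_smul hm
  refine ⟨K, hK, fun a => ?_⟩
  obtain ⟨χ, hχ⟩ := h1 (fun ρ => (a.1 ρ : ℤ), a.2)
  obtain ⟨χ', -, hχ'⟩ := exists_coxExponent_eq (a := K • a) hm (hχ.trans
    (Prod.ext (funext fun ρ => by simp) rfl))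
  exact ⟨χ', hχ'⟩

lemma finite_logClassGroup (h : F.IsCompletion σ w) (hm : ∀ ρ, 0 < m ρ) :
    Finite (F.LogClassGroup m σ w) := by
  have := h.finite
  obtain ⟨K, hK, h1⟩ := h.exists_coxMap_eq_smul hm
  have : AddGroup.FG ((F.raysIn σ → ℤ) × (J → ℤ)) := by
    rw [← Module.Finite.iff_addGroup_fg]; infer_instance
  refine AddCommGroup.finite_of_fg_isAddTorsion _ fun x => ?_
  obtain ⟨z, rfl⟩ := QuotientAddGroup.mk_surjective x
  rw [isOfFinAddOrder_iff_nsmul_eq_zero]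
  refine ⟨K, hK, ?_⟩
  rw [← QuotientAddGroup.mk_nsmul, QuotientAddGroup.eq_zero_iff]
  exact h1 z

end IsCompletion

lemma coxDegree_eq_zero_iff (a : (F.raysIn σ → ℕ) × (J → ℤ)) :
    F.coxDegree m σ w a = 0 ↔ ∃ χ, F.coxMap m σ w χ = (fun ρ => (a.1 ρ : ℤ), a.2) :=
  QuotientAddGroup.eq_zero_iff _

/-- Split the exponents of the `x_ρ` into positive and negative parts; those of the `t_j` may be any
integers. So the degrees of monomials generate the class group, which makes the action of `H`
faithful. -/
lemma exists_coxDegree_sub_eq (x : F.LogClassGroup m σ w) :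
    ∃ a b, x + F.coxDegree m σ w b = F.coxDegree m σ w a := by
  obtain ⟨z, rfl⟩ := QuotientAddGroup.mk_surjective x
  refine ⟨(fun ρ => (z.1 ρ).toNat, z.2), (fun ρ => (-z.1 ρ).toNat, 0), ?_⟩
  change (QuotientAddGroup.mk _ : F.LogClassGroup m σ w) + QuotientAddGroup.mk _ =
    QuotientAddGroup.mk _
  rw [← QuotientAddGroup.mk_add]
  refine congrArg _ (Prod.ext (funext fun ρ => ?_) (add_zero _))
  change z.1 ρ + ((-z.1 ρ).toNat : ℤ) = ((z.1 ρ).toNat : ℤ)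
  omega

lemma coxAction_injective : Function.Injective (F.coxAction m σ w) := by
  intro g g' h
  have h1 : ∀ a, g (F.coxDegree m σ w a) = g' (F.coxDegree m σ w a) := fun a => by
    have h2 := congrArg (fun f : F.coxRing σ J →ₐ[ℂ] F.coxRing σ J => (f (single a 1)).coeff a) h
    simpa [coeff_coxAction] using h2
  refine AddChar.ext _ _ fun x => ?_
  obtain ⟨a, b, hab⟩ := F.exists_coxDegree_sub_eq m σ w x
  have h2 := congrArg g hab
  have h3 := congrArg g' hab
  rw [AddChar.map_add_eq_mul] at h2 h3
  rw [← h1, ← h1, ← h2] at h3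
  exact ((AddChar.val_isUnit g _).mul_right_cancel h3).symm

section

variable {F m σ w} [Module.Free ℤ N] [Module.Finite ℤ N]

namespace IsCompletion

lemma range_coxHom (h : F.IsCompletion σ w) (hm : ∀ ρ, 0 < m ρ) :
    (F.coxHom m σ w).range = (invariants (F.coxAction m σ w)).toSubring := by
  have := h.finite_logClassGroup hm
  ext f
  rw [Subalgebra.mem_toSubring, mem_invariants_iff]
  constructor
  · rintro ⟨f, rfl⟩ g
    induction f using AddMonoidAlgebra.induction_linear with
    | zero => rw [map_zero, map_zero]
    | add f f' hf hf' => rw [map_add, map_add, hf, hf']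
    | single χ c =>
      have h0 : F.coxDegree m σ w (F.coxExponent m σ w χ) = 0 := by
        refine (F.coxDegree_eq_zero_iff m σ w _).2 ⟨χ.1, Prod.ext (funext fun ρ => ?_) rfl⟩
        exact (Int.toNat_of_nonneg (F.apply_nonneg_of_mem_raysIn m σ χ ρ)).symm
      rw [coxHom_single, coxAction_single, h0, AddChar.map_zero_eq_one, one_mul]
  · intro hf
    have h1 : ∀ a ∈ f.coeff.support, ∃ χ, F.coxExponent m σ w χ = a := fun a ha => by
      -- Invariance makes every character equal to one on the degree of each monomial that occurs,
      -- and the characters of a finite abelian group separate its elements.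
      have h2 : F.coxDegree m σ w a = 0 := AddChar.forall_apply_eq_zero.1 fun g => by
        have h3 := congrArg (fun f : F.coxRing σ J => f.coeff a) (hf g)
        rw [coeff_coxAction] at h3
        exact mul_right_cancel₀ (Finsupp.mem_support_iff.1 ha) (h3.trans (one_mul _).symm)
      obtain ⟨χ, hχ⟩ := (F.coxDegree_eq_zero_iff m σ w a).1 h2
      obtain ⟨χ', -, hχ'⟩ := exists_coxExponent_eq hm hχ
      exact ⟨χ', hχ'⟩
    rw [eq_sum_single f]
    refine sum_mem fun a ha => ?_
    obtain ⟨χ, rfl⟩ := h1 a ha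
    exact ⟨single χ _, coxHom_single _ _ _ _ _ _⟩

/-- The `K`-th power of each monomial is a monomial from `S_σ`. -/
lemma isIntegral_coxHom (h : F.IsCompletion σ w) (hm : ∀ ρ, 0 < m ρ) :
    (F.coxHom m σ w).IsIntegral := by
  obtain ⟨K, hK, h1⟩ := h.exists_coxExponent_eq_smul hm
  intro f
  induction f using AddMonoidAlgebra.induction_linear with
  | zero => exact RingHom.isIntegralElem_zero _
  | add f g hf hg => exact RingHom.IsIntegralElem.add _ hf hg
  | single a c =>
    let _ := (F.coxHom m σ w).toAlgebra
    refine IsIntegral.of_pow (R := ℂ[dualMonoid σ.1]) hK ?_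
    obtain ⟨χ, hχ⟩ := h1 a
    rw [single_pow, ← hχ, ← coxHom_single]
    exact isIntegral_algebraMap (R := ℂ[dualMonoid σ.1])

lemma range_coxMorphism (h : F.IsCompletion σ w) (hm : ∀ ρ, 0 < m ρ) :
    Set.range (F.coxMorphism m σ w) = Set.range (F.chart σ) := by
  have h1 : Function.Surjective (Spec.map (CommRingCat.ofHom (F.coxHom m σ w))) :=
    (h.isIntegral_coxHom hm).comap_surjective (h.coxHom_injective hm)
  refine Eq.trans ?_ (h1.range_comp (F.chart σ))
  rfl

lemma exists_quotient_isOpenImmersion (h : F.IsCompletion σ w) (hm : ∀ ρ, 0 < m ρ) :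
    ∃ j : Spec (CommRingCat.of (invariants (F.coxAction m σ w))) ⟶ F.toricVariety,
      IsOpenImmersion j ∧
      Spec.map (CommRingCat.ofHom (invariants (F.coxAction m σ w)).val.toRingHom) ≫ j =
        F.coxMorphism m σ w := by
  let f : ℂ[dualMonoid σ.1] →+* invariants (F.coxAction m σ w) :=
    (F.coxHom m σ w).codRestrict (invariants (F.coxAction m σ w)).toSubring fun x => by
      rw [← h.range_coxHom hm]; exact ⟨x, rfl⟩
  have hf : Function.Bijective f := by
    refine ⟨fun x y hxy => h.coxHom_injective hm (congrArg Subtype.val hxy), fun b => ?_⟩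
    have hb : b.1 ∈ (F.coxHom m σ w).range := by rw [h.range_coxHom hm]; exact b.2
    obtain ⟨x, hx⟩ := hb
    exact ⟨x, Subtype.ext hx⟩
  have : IsIso (CommRingCat.ofHom f) := (RingEquiv.ofBijective f hf).toCommRingCatIso.isIso_hom
  refine ⟨Spec.map (CommRingCat.ofHom f) ≫ F.chart σ, inferInstance, ?_⟩
  rw [← Category.assoc, ← Spec.map_comp]
  rfl

end IsCompletion

end

end Fan

/-! ### The variables `x_ρ` and the ramification over `D_ρ` -/

lemma Toric.span_range_vec {N : Type} [AddCommGroup N] :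
    Submodule.span ℚ (Set.range (vec : N → ℚ ⊗[ℤ] N)) = ⊤ := by
  refine eq_top_iff.2 fun x _ => ?_
  induction x using TensorProduct.induction_on with
  | zero => exact zero_mem _
  | add x y hx hy => exact add_mem (hx trivial) (hy trivial)
  | tmul q v =>
    have : q ⊗ₜ[ℤ] v = q • vec v := by rw [vec, TensorProduct.smul_tmul', smul_eq_mul, mul_one]
    rw [this]
    exact Submodule.smul_mem _ _ (Submodule.subset_span ⟨v, rfl⟩)

namespace Fan

open Toric AddMonoidAlgebra

variable {N : Type} [AddCommGroup N] (F : Fan N) (m : F.rays → ℕ) (σ : F.cones) (J : Type)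
  (w : J → N)

/-- The exponent of the variable `x_ρ` in the monomials of the log Cox ring. -/
def exponentAt (ρ : F.raysIn σ) : (F.raysIn σ → ℕ) × (J → ℤ) →+ ℤ where
  toFun a := (a.1 ρ : ℤ)
  map_zero' := rfl
  map_add' a b := by simp

lemma exponentAt_nonneg (ρ : F.raysIn σ) (a) : 0 ≤ F.exponentAt σ J ρ a := Int.natCast_nonneg _

/-- The variable `x_ρ` of the log Cox ring. -/
def coxVar (ρ : F.raysIn σ) : F.coxRing σ J :=
  open Classical in single (Pi.single ρ 1, 0) 1

/-- The prime ideal of the log Cox ring that is generated by the variable `x_ρ`. -/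
abbrev coxVarIdeal (ρ : F.raysIn σ) : Ideal (F.coxRing σ J) :=
  monomialIdeal (F.exponentAt σ J ρ) (F.exponentAt_nonneg σ J ρ)

/-- The prime divisor of the log Cox construction on which the variable `x_ρ` vanishes. -/
def coxVarPoint (ρ : F.raysIn σ) : PrimeSpectrum (F.coxRing σ J) :=
  ⟨F.coxVarIdeal σ J ρ, isPrime_monomialIdeal⟩

lemma coxVar_mem (ρ : F.raysIn σ) : F.coxVar σ J ρ ∈ F.coxVarIdeal σ J ρ := by
  refine (single_mem_monomialIdeal one_ne_zero).2 ?_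
  simp [exponentAt]

lemma coxVarIdeal_eq_span (ρ : F.raysIn σ) :
    F.coxVarIdeal σ J ρ = Ideal.span {F.coxVar σ J ρ} := by
  classical
  refine monomialIdeal_eq_span (by simp [exponentAt]) fun a ha =>
    ⟨(a.1 - Pi.single ρ 1, a.2), Prod.ext (funext fun ρ' => ?_) (zero_add _).symm⟩
  -- This makes the truncated subtraction of `Pi.single ρ 1` exact.
  have h1 : a.1 ρ ≠ 0 := fun h => ha (by simp [exponentAt, h])
  change a.1 ρ' = (Pi.single ρ 1 : F.raysIn σ → ℕ) ρ' +
    (a.1 ρ' - (Pi.single ρ 1 : F.raysIn σ → ℕ) ρ')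
  rcases eq_or_ne ρ' ρ with rfl | h
  · rw [Pi.single_eq_same]; omega
  · rw [Pi.single_eq_of_ne h]; omega

lemma coxVar_pow (ρ : F.raysIn σ) (k : ℕ) :
    F.coxVar σ J ρ ^ k = open Classical in single (Pi.single ρ k, 0) 1 := by
  classical
  rw [coxVar, single_pow, one_pow]
  congr 1
  refine Prod.ext (funext fun ρ' => ?_) (smul_zero k)
  change k • (Pi.single ρ 1 : F.raysIn σ → ℕ) ρ' = (Pi.single ρ k : F.raysIn σ → ℕ) ρ'
  rcases eq_or_ne ρ' ρ with rfl | h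
  · simp
  · simp [h]

variable {J}

lemma exists_single_eq_coxVar_pow_mul (ρ : F.raysIn σ) {a : (F.raysIn σ → ℕ) × (J → ℤ)} {k : ℕ}
    (h : k ≤ a.1 ρ) (c : ℂ) : ∃ b : (F.raysIn σ → ℕ) × (J → ℤ), b.1 ρ = a.1 ρ - k ∧
      single a c = F.coxVar σ J ρ ^ k * single b c := by
  classical
  refine ⟨(a.1 - Pi.single ρ k, a.2), ?_, ?_⟩
  · simp
  · rw [coxVar_pow, single_mul_single, one_mul]
    congr 1
    refine Prod.ext (funext fun ρ' => ?_) (zero_add _).symm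
    change a.1 ρ' = (Pi.single ρ k : F.raysIn σ → ℕ) ρ' +
      (a.1 ρ' - (Pi.single ρ k : F.raysIn σ → ℕ) ρ')
    rcases eq_or_ne ρ' ρ with rfl | h
    · rw [Pi.single_eq_same]; omega
    · rw [Pi.single_eq_of_ne h]; omega

/-- Lattice vectors span `N_ℚ`, so the independent rays extend to a basis consisting of lattice
vectors; `J` is the set of the added ones. -/
lemma exists_isCompletion {σ : F.cones}
    (h : LinearIndependent ℚ (fun ρ : F.raysIn σ => vec ρ.1.1)) :
    ∃ (J : Type) (w : J → N), F.IsCompletion σ w := by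
  let s : Set N := Set.range fun ρ : F.raysIn σ => ρ.1.1
  have hs : LinearIndepOn ℚ vec s := (linearIndepOn_range_iff
    (Subtype.val_injective.comp Subtype.val_injective) _).2 h
  obtain ⟨b, -, hsb, hspan, hb⟩ := exists_linearIndepOn_extension hs (Set.subset_univ s)
  refine ⟨↥(b \ s), Subtype.val, ?_, ?_⟩
  · let g : F.raysIn σ ⊕ ↥(b \ s) → b :=
      Sum.elim (fun ρ => ⟨ρ.1.1, hsb ⟨ρ, rfl⟩⟩) fun j => ⟨j.1, j.2.1⟩
    have hg : Function.Injective g := by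
      rintro (ρ | j) (ρ' | j') h
      · exact congrArg Sum.inl (Subtype.ext (Subtype.ext (congrArg (fun x : b => x.1) h)))
      · exact absurd ⟨ρ, congrArg Subtype.val h⟩ j'.2.2
      · exact absurd ⟨ρ', (congrArg Subtype.val h).symm⟩ j.2.2
      · exact congrArg Sum.inr (Subtype.ext (congrArg (fun x : b => x.1) h))
    have h1 : Sum.elim (fun ρ : F.raysIn σ => vec ρ.1.1) (fun j : ↥(b \ s) => vec j.1) =
        (fun x : b => vec x.1) ∘ g := funext fun i => by cases i <;> rfl
    rw [h1]
    exact LinearIndependent.comp hb g hg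
  · rw [Set.image_univ, ← Submodule.span_le, span_range_vec, top_le_iff] at hspan
    rw [← hspan]
    congr 1
    ext x
    constructor
    · rintro ⟨ρ | j, rfl⟩
      · exact ⟨_, hsb ⟨ρ, rfl⟩, rfl⟩
      · exact ⟨_, j.2.1, rfl⟩
    · rintro ⟨v, hv, rfl⟩
      by_cases hvs : v ∈ s
      · obtain ⟨ρ, rfl⟩ := hvs
        exact ⟨Sum.inl ρ, rfl⟩
      · exact ⟨Sum.inr ⟨v, hv, hvs⟩, rfl⟩

namespace IsCompletion

variable {F m σ w}

lemma isDomain_coxRing [Module.Finite ℤ N] (h : F.IsCompletion σ w) : IsDomain (F.coxRing σ J) := by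
  have := h.finite
  infer_instance

lemma comap_coxVarIdeal (h : F.IsCompletion σ w) (hm : ∀ ρ, 0 < m ρ) (ρ : F.raysIn σ) :
    (F.coxVarIdeal σ J ρ).comap (F.coxHom m σ w) = orbitIdeal σ.1 ρ.1.1 ρ.2 := by
  refine comap_monomialIdeal (hφ := evalAt_nonneg ρ.2) (hφ' := F.exponentAt_nonneg σ J ρ)
    (h.coxExponent_injective hm) fun χ => ?_
  have h1 : F.exponentAt σ J ρ (F.coxExponent m σ w χ) = _ := F.coxExponent_fst m σ w χ ρ
  refine Iff.trans ?_ (iff_of_eq (congrArg (· = 0) h1)).symm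
  rw [mul_eq_zero, evalAt_apply]
  have h2 : (m ρ.1 : ℤ) ≠ 0 := by exact_mod_cast (hm _).ne'
  exact ⟨Or.inr, fun h => h.resolve_left h2⟩

/-- The ideal `(x_ρ)` is a nonzero prime, and a prime of height one contains no other nonzero prime.
-/
lemma eq_coxVarPoint_of_mem [Module.Finite ℤ N] (h : F.IsCompletion σ w)
    {y : PrimeSpectrum (F.coxRing σ J)} (hy : y.asIdeal.height = 1) {ρ : F.raysIn σ}
    (hρ : F.coxVar σ J ρ ∈ y.asIdeal) :
    y = F.coxVarPoint σ J ρ := by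
  have := h.isDomain_coxRing
  have : (F.coxVarIdeal σ J ρ).IsPrime := (F.coxVarPoint σ J ρ).2
  refine PrimeSpectrum.ext
    (Ideal.eq_of_le_of_height_eq_one (P := F.coxVarIdeal σ J ρ) ?_ ?_ hy).symm
  · rw [coxVarIdeal_eq_span, Ne, Ideal.span_singleton_eq_bot]
    exact fun h => one_ne_zero (α := ℂ) (single_eq_zero.1 h)
  · rw [coxVarIdeal_eq_span, Ideal.span_singleton_le_iff_mem]
    exact hρ

end IsCompletion

variable [Module.Free ℤ N]

/-- A prime ideal without variables contains no monomials. -/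
lemma single_notMem_of_coxVar_notMem {y : Ideal (F.coxRing σ J)} (hp : y.IsPrime)
    (hy : ∀ ρ, F.coxVar σ J ρ ∉ y) (a : (F.raysIn σ → ℕ) × (J → ℤ)) : single a (1 : ℂ) ∉ y := by
  classical
  -- The exponents of monomials outside a prime form a submonoid. It contains those of the units
  -- `t^e` and of the variables, which generate everything.
  let S : AddSubmonoid ((F.raysIn σ → ℕ) × (J → ℤ)) :=
    { carrier := {a | single a (1 : ℂ) ∉ y}
      zero_mem' := fun h => hp.ne_top ((Ideal.eq_top_iff_one _).2 h)
      add_mem' := fun {a b} ha hb h => by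
        rw [← one_mul (1 : ℂ), ← single_mul_single] at h
        exact (hp.mem_or_mem h).elim ha hb }
  have h1 : ((0, a.2) : (F.raysIn σ → ℕ) × (J → ℤ)) ∈ S := fun h => by
    refine hp.ne_top (Ideal.eq_top_of_isUnit_mem _ h (IsUnit.of_mul_eq_one (single (0, -a.2) 1) ?_))
    rw [single_mul_single, AddMonoidAlgebra.one_def, one_mul]
    congr 1
    exact Prod.ext (add_zero _) (add_neg_cancel _)
  have h2 : a = (0, a.2) + ∑ ρ, a.1 ρ • ((Pi.single ρ 1, 0) : (F.raysIn σ → ℕ) × (J → ℤ)) := by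
    refine Prod.ext (funext fun ρ' => ?_) ?_
    · rw [Prod.fst_add, Prod.fst_sum, Pi.add_apply, Finset.sum_apply]
      simp [Pi.single_apply]
    · rw [Prod.snd_add, Prod.snd_sum]
      simp
  change a ∈ S
  rw [h2]
  exact add_mem h1 (sum_mem fun ρ _ => nsmul_mem (show _ ∈ S from hy ρ) _)

variable [Module.Finite ℤ N]

/-- There is a character in `S_σ` that has value one on a given ray. -/
lemma exists_mem_dualMonoid_apply_eq_one {σ : F.cones}
    (h : LinearIndependent ℚ (fun ρ : F.raysIn σ => vec ρ.1.1)) (ρ : F.raysIn σ) :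
    ∃ χ ∈ dualMonoid σ.1, χ ρ.1.1 = 1 := by
  classical
  obtain ⟨χ, hχ⟩ := ρ.1.2.1.exists_dual_eq_one
  obtain ⟨k, hk, h1⟩ := exists_dual_apply_eq h
  -- The character `χ` has value one at `u_ρ` but may be negative on other rays. By independence
  -- there is `θ` that is zero at `u_ρ` and `k > 0` at the others, and a large multiple of it
  -- corrects the signs.
  obtain ⟨θ, hθ⟩ := h1 fun ρ' => if ρ' = ρ then 0 else 1
  refine ⟨χ + (∑ ρ' : F.raysIn σ, |χ ρ'.1.1|) • θ, (F.mem_dualMonoid_iff σ _).2 fun ρ' => ?_, ?_⟩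
  · rw [LinearMap.add_apply, LinearMap.smul_apply, hθ, smul_eq_mul]
    rcases eq_or_ne ρ' ρ with rfl | h
    · rw [if_pos rfl, hχ]; simp
    · rw [if_neg h, mul_one]
      have h2 : |χ ρ'.1.1| ≤ ∑ ρ' : F.raysIn σ, |χ ρ'.1.1| :=
        Finset.single_le_sum (f := fun ρ' : F.raysIn σ => |χ ρ'.1.1|)
          (fun _ _ => abs_nonneg _) (Finset.mem_univ ρ')
      have h3 := neg_abs_le (χ ρ'.1.1)
      have h4 : (1 : ℤ) ≤ k := by exact_mod_cast hk
      nlinarith [abs_nonneg (χ ρ'.1.1)]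
  · rw [LinearMap.add_apply, LinearMap.smul_apply, hθ, if_pos rfl, hχ]; simp

namespace IsCompletion

variable {F m σ w}

lemma smooth_coxRing (h : F.IsCompletion σ w) : Algebra.Smooth ℂ (F.coxRing σ J) := by
  have := h.finite
  exact smooth_mixedLaurent

lemma coxMorphism_coxVarPoint (h : F.IsCompletion σ w) (hm : ∀ ρ, 0 < m ρ) (ρ : F.raysIn σ) :
    F.coxMorphism m σ w (F.coxVarPoint σ J ρ) = F.divisor ρ.1 := by
  rw [F.divisor_eq σ ρ.1 ρ.2]
  exact congrArg (F.chart σ) (PrimeSpectrum.ext (h.comap_coxVarIdeal hm ρ))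

/-- Some power of `x_ρ` comes from `ℂ[S_σ]`, so every prime over `D_ρ` contains `(x_ρ)`, which
itself lies over `D_ρ`. Primes with the same contraction in an integral extension are incomparable.
-/
lemma eq_coxVarPoint_of_coxMorphism_eq (h : F.IsCompletion σ w) (hm : ∀ ρ, 0 < m ρ)
    {y : PrimeSpectrum (F.coxRing σ J)} {ρ : F.raysIn σ}
    (hy : F.coxMorphism m σ w y = F.divisor ρ.1) : y = F.coxVarPoint σ J ρ := by
  rw [← h.coxMorphism_coxVarPoint hm] at hy
  have h1 : y.comap (F.coxHom m σ w) = (F.coxVarPoint σ J ρ).comap (F.coxHom m σ w) :=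
    (F.chart σ).isOpenEmbedding.injective hy
  have h2 : y.asIdeal.comap (F.coxHom m σ w) =
      (F.coxVarIdeal σ J ρ).comap (F.coxHom m σ w) := congrArg PrimeSpectrum.asIdeal h1
  have hp : (F.coxVarIdeal σ J ρ).IsPrime := (F.coxVarPoint σ J ρ).2
  have hx : F.coxVar σ J ρ ∈ y.asIdeal := by
    obtain ⟨K, hK, h3⟩ := h.exists_coxExponent_eq_smul hm
    classical
    obtain ⟨χ, hχ⟩ := h3 (Pi.single ρ 1, 0)
    have h4 : F.coxHom m σ w (single χ 1) = F.coxVar σ J ρ ^ K := by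
      rw [coxHom_single, hχ, coxVar, single_pow, one_pow]
    refine y.2.mem_of_pow_mem K ?_
    rw [← h4, ← Ideal.mem_comap, h2, Ideal.mem_comap, h4]
    exact Ideal.pow_mem_of_mem _ (F.coxVar_mem σ J ρ) _ hK
  have hle : F.coxVarIdeal σ J ρ ≤ y.asIdeal := by
    rw [coxVarIdeal_eq_span, Ideal.span_singleton_le_iff_mem]
    exact hx
  refine PrimeSpectrum.ext (le_antisymm (fun f hf => ?_) hle)
  by_contra hf'
  let _ := (F.coxHom m σ w).toAlgebra
  exact (Ideal.comap_lt_comap_of_integral_mem_sdiff hle ⟨hf, hf'⟩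
    (h.isIntegral_coxHom hm f)).ne h2.symm

/-- Characters in the ideal of `D_ρ` have value at least one at `u_ρ`, so their pullbacks are
divisible by `x_ρ ^ m_ρ`. A character with value exactly one gives `x_ρ ^ m_ρ` times a monomial
without `x_ρ`, which is a unit at `(x_ρ)`. -/
lemma hasRamificationIndex_coxVarPoint (h : F.IsCompletion σ w) (hm : ∀ ρ, 0 < m ρ)
    (ρ : F.raysIn σ) :
    HasRamificationIndex (F.coxMorphism m σ w) (F.coxVarPoint σ J ρ) (m ρ.1) := by
  refine (hasRamificationIndex_iff _ _ (F.coxVarPoint σ J ρ) _).2 ?_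
  let S := Localization.AtPrime (F.coxVarPoint σ J ρ).asIdeal
  change (((F.coxVarIdeal σ J ρ).comap (F.coxHom m σ w)).map (F.coxHom m σ w)).map
    (algebraMap _ S) = (F.coxVarIdeal σ J ρ).map (algebraMap _ S) ^ m ρ.1
  rw [h.comap_coxVarIdeal hm, ← Ideal.map_pow, coxVarIdeal_eq_span, Ideal.span_singleton_pow]
  apply le_antisymm
  · refine Ideal.map_mono (Ideal.map_le_iff_le_comap.2 fun f hf => ?_)
    rw [eq_sum_single f]
    refine sum_mem fun χ hχ => ?_
    rw [Ideal.mem_comap, coxHom_single, Ideal.mem_span_singleton]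
    have h1 : χ.1 ρ.1.1 ≠ 0 := fun h0 => Finsupp.mem_support_iff.1 hχ (hf χ h0)
    have h2 := evalAt_nonneg ρ.2 χ
    rw [evalAt_apply] at h2
    have h3 := F.coxExponent_fst m σ w χ ρ
    have h4 : m ρ.1 ≤ (F.coxExponent m σ w χ).1 ρ := by
      zify
      rw [h3]
      exact le_mul_of_one_le_right (by positivity) (by omega)
    obtain ⟨b, -, hb⟩ := F.exists_single_eq_coxVar_pow_mul σ ρ h4 (f.coeff χ)
    exact ⟨_, hb⟩
  · rw [Ideal.map_span, Set.image_singleton, Ideal.span_singleton_le_iff_mem]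
    obtain ⟨χ, hχ, hχ1⟩ := F.exists_mem_dualMonoid_apply_eq_one
      (h.linearIndependent.comp Sum.inl Sum.inl_injective) ρ
    have h3 := F.coxExponent_fst m σ w ⟨χ, hχ⟩ ρ
    rw [hχ1, mul_one] at h3
    obtain ⟨b, hb0, hb⟩ := F.exists_single_eq_coxVar_pow_mul σ ρ
      (a := F.coxExponent m σ w ⟨χ, hχ⟩) (k := m ρ.1) (by omega) 1
    have hu : IsUnit (algebraMap (F.coxRing σ J) S (single b 1)) := by
      refine IsLocalization.map_units S (⟨single b 1, fun hmem => ?_⟩ :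
        (F.coxVarPoint σ J ρ).asIdeal.primeCompl)
      refine (single_mem_monomialIdeal (hφ := F.exponentAt_nonneg σ J ρ) one_ne_zero).1 hmem ?_
      change (b.1 ρ : ℤ) = 0
      omega
    rw [← Ideal.mul_unit_mem_iff_mem _ hu, ← map_mul, ← hb, ← coxHom_single]
    refine Ideal.mem_map_of_mem _ (Ideal.mem_map_of_mem _ ?_)
    exact (single_mem_monomialIdeal one_ne_zero).2 (by rw [evalAt_apply, hχ1]; exact one_ne_zero)

lemma hasRamificationIndex_one (h : F.IsCompletion σ w) (hm : ∀ ρ, 0 < m ρ)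
    {y : PrimeSpectrum (F.coxRing σ J)} (hy : ∀ ρ, F.coxVar σ J ρ ∉ y.asIdeal) :
    HasRamificationIndex (F.coxMorphism m σ w) y 1 := by
  have := h.finite
  have := fg_mixedExponents (I := F.raysIn σ) (J := J)
  obtain ⟨K, hK, h1⟩ := h.exists_coxExponent_eq_smul hm
  refine (hasRamificationIndex_iff _ _ y _).2 ?_
  rw [pow_one]
  refine map_comap_eq_of_single_notMem _ (F.coxHom_comp_algebraMap m σ w) hK (fun a => ?_) _
    (F.single_notMem_of_coxVar_notMem σ y.2 hy)
  obtain ⟨χ, hχ⟩ := h1 a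
  exact ⟨single χ 1, by rw [coxHom_single, hχ]⟩

lemma exists_hasRamificationIndex (h : F.IsCompletion σ w) (hm : ∀ ρ, 0 < m ρ)
    {y : PrimeSpectrum (F.coxRing σ J)} (hy : y.asIdeal.height = 1) :
    ∃ e : ℕ, 0 < e ∧ HasRamificationIndex (F.coxMorphism m σ w) y e ∧
      F.boundary m (F.coxMorphism m σ w y) = 1 - 1 / (e : ℚ) := by
  by_cases hx : ∃ ρ, F.coxVar σ J ρ ∈ y.asIdeal
  · obtain ⟨ρ, hρ⟩ := hx
    obtain rfl := h.eq_coxVarPoint_of_mem hy hρ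
    exact ⟨m ρ.1, hm _, h.hasRamificationIndex_coxVarPoint hm ρ,
      (congrArg (F.boundary m) (h.coxMorphism_coxVarPoint hm ρ)).trans (F.boundary_divisor m ρ.1)⟩
  · refine ⟨1, one_pos, h.hasRamificationIndex_one hm (not_exists.1 hx), ?_⟩
    -- A point over some `D_ρ` would be `(x_ρ)` and contain a variable.
    rw [F.boundary_eq_zero m fun ρ h1 => ?_]
    · norm_num
    · have hρ : ρ ∈ F.raysIn σ := F.mem_raysIn_of_divisor_eq
        (y := Spec.map (CommRingCat.ofHom (F.coxHom m σ w)) y) h1.symm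
      obtain rfl := h.eq_coxVarPoint_of_coxMorphism_eq hm (ρ := ⟨ρ, hρ⟩) h1
      exact hx ⟨_, F.coxVar_mem σ J _⟩

lemma isOrbifoldChart (h : F.IsCompletion σ w) (hm : ∀ ρ, 0 < m ρ) :
    IsOrbifoldChart F.structureMap (F.boundary m) (F.coxAction m σ w) (F.coxMorphism m σ w) where
  isDomain := h.isDomain_coxRing
  smooth := h.smooth_coxRing
  finite := by
    have := h.finite_logClassGroup hm
    infer_instance
  faithful := F.coxAction_injective m σ w
  comp_eq := F.coxMorphism_structureMap m σ w
  quotient := h.exists_quotient_isOpenImmersion hm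
  ramification y hy := h.exists_hasRamificationIndex hm
    ((idealHeight_eq_coheight (CommRingCat.of (F.coxRing σ J)) y).trans hy)

end IsCompletion

end Fan

end

theorem proposition3p1 {N : Type} [AddCommGroup N] [Module.Free ℤ N] [Module.Finite ℤ N]
    (F : Fan N) (hF : IsQFactorial F.toricVariety)
    (m : F.rays → ℕ) (hm : ∀ ρ, 0 < m ρ) :
    IsOrbifold F.structureMap (F.boundary m) ∧
    ∀ σ : F.cones,
      LinearIndependent ℚ (fun ρ : F.raysIn σ => Toric.vec ρ.1.1) ∧
      ∀ (J : Type) (w : J → N),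
        LinearIndependent ℚ
          (Sum.elim (fun ρ : F.raysIn σ => Toric.vec ρ.1.1) (fun j => Toric.vec (w j))) →
        Submodule.span ℚ (Set.range
          (Sum.elim (fun ρ : F.raysIn σ => Toric.vec ρ.1.1) (fun j => Toric.vec (w j)))) = ⊤ →
        IsOrbifoldChart F.structureMap (F.boundary m)
          (F.coxAction m σ w) (F.coxMorphism m σ w) ∧
        Set.range (F.coxMorphism m σ w) = Set.range (F.chart σ) ∧
        ∀ ρ ∈ F.raysIn σ, ∀ y, F.coxMorphism m σ w y = F.divisor ρ →
          HasRamificationIndex (F.coxMorphism m σ w) y (m ρ) := by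
  have hli := F.linearIndependent_rays hF
  refine ⟨fun x => ?_, fun σ => ⟨hli σ, fun J w hw hw' => ?_⟩⟩
  · obtain ⟨σ, y, rfl⟩ := F.exists_chart_eq x
    obtain ⟨J, w, h⟩ := F.exists_isCompletion (hli σ)
    refine ⟨_, _, _, _, _, _, _, h.isOrbifoldChart hm, ?_⟩
    rw [h.range_coxMorphism hm]
    exact ⟨y, rfl⟩
  · have h : F.IsCompletion σ w := ⟨hw, hw'⟩
    refine ⟨h.isOrbifoldChart hm, h.range_coxMorphism hm, fun ρ hρ y hy => ?_⟩
    obtain rfl := h.eq_coxVarPoint_of_coxMorphism_eq hm (ρ := ⟨ρ, hρ⟩) hy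
    exact h.hasRamificationIndex_coxVarPoint hm ⟨ρ, hρ⟩
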